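/- Let $$T^*S^n=\{(u,v)\in\mathbb R^{n+1}\times\mathbb R^{n+1} : |u|=1,\ \langle u,v\rangle=0\}$$ with the exact symplectic form $\omega=\sum_i du_i\wedge dv_i$ (restricted from $\mathbb R^{n+1}\times\mathbb R^{n+1}$), and let $\mu(u,v)=|v|$. Let $\rho:\mathbb R\to\mathbb R$ be a $C^\infty$ function which vanishes for all sufficiently large $t$ and satisfies $\rho(-t)=\rho(t)-t$ for small $|t|$, and let $(\phi_t)$ be the Hamiltonian flow of $\rho(\mu)$ on the complement of the zero section (with the convention $\omega(X_h,\cdot)=dh$). Let $\mathrm{Diff}_c(T^*S^n)$ be the group of compactly supported diffeomorphisms of $T^*S^n$, and $\pi_0(\mathrm{Diff}_c(T^*S^n))$ its quotient by the normal subgroup of diffeomorphisms that are joined to the identity by a smooth compactly supported isotopy. Proposition. Assume $n=2$ or $n=6$. Then $\phi_{2\pi}$ extends over the zero section to a unique compactly supported diffeomorphism $\tau$ of $T^*S^n$ (the Dehn twist), and $[\tau]\in\pi_0(\mathrm{Diff}_c(T^*S^n))$ has order $2$. That is, $\tau^2$ is smoothly compactly supported isotopic to the identity, and $\tau$ is not.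 Moreover, the isotopy for $\tau^2$ can be described explicitly, as follows. There exist cross products on $\mathbb R^{n+1}$, i.e. bilinear maps $\times$ such that $a\times b$ is orthogonal to $a$ and $b$ and $|a\times b|^2=|a|^2|b|^2-\langle a,b\rangle^2$. Let $\times$ be any cross product on $\mathbb R^{n+1}$, let $R>1$, and let $\theta:\mathbb R\to\mathbb R$ be any $C^\infty$ function with $\theta(r)=0$ for $r<1$ and $\theta(r)=2\pi$ for $r>R$. For linearly independent $a,b$ let $R^{\alpha}_{(a,b)}$ be the rotation by the angle $\alpha$ in the plane spanned by $a,b$, oriented by $(a,b)$, which fixes the orthogonal complement of that plane. For a function $\eta:\mathbb R\to\mathbb R$ and $t\in[0,1]$ put $$S^{\eta}_t(u,v)=\begin{cases}\bigl(R^{\eta(|v|)}_{((1-t)u+t\,u\times v,\;v)}u,\ R^{\eta(|v|)}_{((1-t)u+t\,u\times v,\;v)}v\bigr)& v\ne0,\\ (u,v)& v=0.\end{cases}$$ Then $(S^{\theta}_t)_{t\in[0,1]}$ is a smooth compactly supported isotopy of $T^*S^n$, $S^\theta_0$ represents $[\tau^2]$, and, with $\theta_s=(1-s)\theta+2\pi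 s$, $(S^{\theta_s}_1)_{s\in[0,1]}$ is a smooth compactly supported isotopy of $T^*S^n$ from $S^\theta_1$ to the identity. -/

import Mathlib

open scoped ContDiff

noncomputable section

namespace DehnTwist

/-- The Euclidean space `ℝⁿ⁺¹`. -/
abbrev E (n : ℕ) : Type := EuclideanSpace ℝ (Fin (n + 1))

/-- `T*Sⁿ = {(u, v) ∈ ℝⁿ⁺¹ × ℝⁿ⁺¹ : |u| = 1, ⟨u, v⟩ = 0}`, with the subspace topology. -/
abbrev CotangentSphere (n : ℕ) : Type :=
  {p : E n × E n // ‖p.1‖ = 1 ∧ inner ℝ p.1 p.2 = 0}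

/-! ### Smooth maps between subsets of normed spaces -/

/-- `f : α → β` is smooth, where `α` and `β` are regarded as subsets of the normed spaces `V` and
`W` via the injections `i` and `j`: near every point of `α`, `f` is the restriction of a
`C^∞` map that is defined on an open subset of `V`. -/
def IsSmooth {α β V W : Type*} [NormedAddCommGroup V] [NormedSpace ℝ V]
    [NormedAddCommGroup W] [NormedSpace ℝ W] (i : α → V) (j : β → W) (f : α → β) : Prop :=
  ∀ a : α, ∃ U : Set V, IsOpen U ∧ i a ∈ U ∧ ∃ F : V → W,
    ContDiffOn ℝ ∞ F U ∧ ∀ x : α, i x ∈ U → F (i x) = j (f x)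

theorem IsSmooth.comp {α β γ V W Z : Type*} [NormedAddCommGroup V] [NormedSpace ℝ V]
    [NormedAddCommGroup W] [NormedSpace ℝ W] [NormedAddCommGroup Z] [NormedSpace ℝ Z]
    {i : α → V} {j : β → W} {k : γ → Z} {g : β → γ} {f : α → β}
    (hg : IsSmooth j k g) (hf : IsSmooth i j f) : IsSmooth i k (g ∘ f) := by
  intro a
  obtain ⟨U, hU, haU, F, hF, hFf⟩ := hf a
  obtain ⟨U', hU', haU', G, hG, hGg⟩ := hg (f a)
  refine ⟨U ∩ F ⁻¹' U', hF.continuousOn.isOpen_inter_preimage hU hU', ⟨haU, ?_⟩, G ∘ F,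
    hG.comp (hF.mono Set.inter_subset_left) fun x hx => hx.2, ?_⟩
  · rw [Set.mem_preimage, hFf a haU]; exact haU'
  · rintro x ⟨hx, hx'⟩
    rw [Set.mem_preimage, hFf x hx] at hx'
    simp only [Function.comp_apply, hFf x hx, hGg (f x) hx']

theorem IsSmooth.ident {α V : Type*} [NormedAddCommGroup V] [NormedSpace ℝ V] (i : α → V) :
    IsSmooth i i (fun x => x) :=
  fun _ => ⟨Set.univ, isOpen_univ, trivial, fun x => x, contDiff_id.contDiffOn, fun _ _ => rfl⟩

/-- The inclusion `T*Sⁿ ⊆ ℝⁿ⁺¹ × ℝⁿ⁺¹`. -/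
def incl (n : ℕ) : CotangentSphere n → E n × E n := Subtype.val

/-- The inclusion `[0,1] × T*Sⁿ ⊆ ℝ × (ℝⁿ⁺¹ × ℝⁿ⁺¹)`. -/
def inclI (n : ℕ) : unitInterval × CotangentSphere n → ℝ × (E n × E n) :=
  fun q => ((q.1 : ℝ), (q.2 : E n × E n))

/-! ### The compactly supported mapping class group -/

/-- The group `Diff_c(T*Sⁿ)` of compactly supported diffeomorphisms of `T*Sⁿ`, under
composition. -/
def DiffC (n : ℕ) : Subgroup (Equiv.Perm (CotangentSphere n)) where
  carrier := {f | IsSmooth (incl n) (incl n) f ∧ IsSmooth (incl n) (incl n) f.symm ∧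
    ∃ K : Set (CotangentSphere n), IsCompact K ∧ ∀ x ∉ K, f x = x}
  one_mem' := ⟨IsSmooth.ident _, IsSmooth.ident _, ∅, isCompact_empty, fun _ _ => rfl⟩
  mul_mem' := by
    rintro f g ⟨hf, hf', K, hK, hfK⟩ ⟨hg, hg', L, hL, hgL⟩
    refine ⟨hf.comp hg, hg'.comp hf', K ∪ L, hK.union hL, fun x hx => ?_⟩
    rw [Set.mem_union, not_or] at hx
    rw [Equiv.Perm.mul_apply, hgL x hx.2, hfK x hx.1]
  inv_mem' := by
    rintro f ⟨hf, hf', K, hK, hfK⟩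
    exact ⟨hf', hf, K, hK, fun x hx => (Equiv.symm_apply_eq f).2 (hfK x hx).symm⟩

/-- A smooth compactly supported isotopy `(H_t)`, `t ∈ [0,1]`, of `T*Sⁿ`: the maps `H_t` are
diffeomorphisms which are the identity outside one compact set, and `(t, x) ↦ (t, H_t x)` is a
diffeomorphism of `[0,1] × T*Sⁿ`. -/
def IsIsotopy {n : ℕ} (H : unitInterval → DiffC n) : Prop :=
  IsSmooth (inclI n) (incl n) (fun q => (H q.1 : Equiv.Perm (CotangentSphere n)) q.2) ∧
  IsSmooth (inclI n) (incl n) (fun q => (H q.1 : Equiv.Perm (CotangentSphere n)).symm q.2) ∧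
  ∃ K : Set (CotangentSphere n), IsCompact K ∧
    ∀ t, ∀ x ∉ K, (H t : Equiv.Perm (CotangentSphere n)) x = x

theorem isSmooth_graph {n : ℕ} {h : unitInterval × CotangentSphere n → CotangentSphere n}
    (hh : IsSmooth (inclI n) (incl n) h) :
    IsSmooth (inclI n) (inclI n) (fun q => (q.1, h q)) := by
  intro a
  obtain ⟨U, hU, ha, F, hF, hFh⟩ := hh a
  refine ⟨U, hU, ha, fun y => (y.1, F y), contDiff_fst.contDiffOn.prodMk hF, fun x hx => ?_⟩
  simp only [hFh x hx]
  rfl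

theorem isSmooth_snd (n : ℕ) : IsSmooth (inclI n) (incl n) Prod.snd :=
  fun _ => ⟨Set.univ, isOpen_univ, trivial, Prod.snd, contDiff_snd.contDiffOn, fun _ _ => rfl⟩

theorem IsIsotopy.const {n : ℕ} (f : DiffC n) : IsIsotopy (fun _ => f) :=
  ⟨f.2.1.comp (isSmooth_snd n), f.2.2.1.comp (isSmooth_snd n),
    f.2.2.2.imp fun _ h => ⟨h.1, fun _ => h.2⟩⟩

theorem IsIsotopy.mul {n : ℕ} {G H : unitInterval → DiffC n} (hG : IsIsotopy G)
    (hH : IsIsotopy H) : IsIsotopy (fun t => G t * H t) := by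
  obtain ⟨hG, hG', K, hK, hGK⟩ := hG
  obtain ⟨hH, hH', L, hL, hHL⟩ := hH
  refine ⟨hG.comp (isSmooth_graph hH), hH'.comp (isSmooth_graph hG'), K ∪ L, hK.union hL,
    fun t x hx => ?_⟩
  rw [Set.mem_union, not_or] at hx
  rw [Subgroup.coe_mul, Equiv.Perm.mul_apply, hHL t x hx.2, hGK t x hx.1]

theorem IsIsotopy.inv {n : ℕ} {H : unitInterval → DiffC n} (hH : IsIsotopy H) :
    IsIsotopy (fun t => (H t)⁻¹) := by
  obtain ⟨hH, hH', K, hK, hHK⟩ := hH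
  exact ⟨hH', hH, K, hK, fun t x hx => (Equiv.symm_apply_eq _).2 (hHK t x hx).symm⟩

/-- The subgroup of those `f ∈ Diff_c(T*Sⁿ)` that are joined to the identity by a smooth compactly
supported isotopy. -/
def isotopicToId (n : ℕ) : Subgroup (DiffC n) where
  carrier := {f | ∃ H : unitInterval → DiffC n, IsIsotopy H ∧ H 0 = f ∧ H 1 = 1}
  one_mem' := ⟨fun _ => 1, IsIsotopy.const 1, rfl, rfl⟩
  mul_mem' := by
    rintro f g ⟨G, hG, rfl, hG1⟩ ⟨H, hH, rfl, hH1⟩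
    exact ⟨fun t => G t * H t, hG.mul hH, rfl, by simp [hG1, hH1]⟩
  inv_mem' := by
    rintro f ⟨H, hH, rfl, hH1⟩
    exact ⟨fun t => (H t)⁻¹, hH.inv, rfl, by simp [hH1]⟩

instance isotopicToId_normal (n : ℕ) : (isotopicToId n).Normal where
  conj_mem := by
    rintro f ⟨H, hH, rfl, hH1⟩ g
    exact ⟨fun t => g * H t * g⁻¹, ((IsIsotopy.const g).mul hH).mul (IsIsotopy.const g⁻¹), rfl,
      by simp [hH1]⟩

/-- The group `π₀ Diff_c(T*Sⁿ)` of isotopy classes of compactly supported diffeomorphisms.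
Here `f` and `g` have the same class iff `f⁻¹ ∘ g` is isotopic to the identity, that is,
iff `f` and `g` are isotopic. -/
abbrev MappingClassGroup (n : ℕ) : Type := DiffC n ⧸ isotopicToId n

/-- The isotopy class of `f`. -/
def isotopyClass {n : ℕ} (f : DiffC n) : MappingClassGroup n := QuotientGroup.mk f

/-! ### The Dehn twist -/

/-- The tangent space of `T*Sⁿ` at `p = (u, v)`, as a subset of `ℝⁿ⁺¹ × ℝⁿ⁺¹`: the kernel of the
differentials of the defining equations `⟨u, u⟩ = 1` and `⟨u, v⟩ = 0`. -/
def tangentSet {n : ℕ} (p : E n × E n) : Set (E n × E n) :=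
  {w | inner ℝ p.1 w.1 = 0 ∧ inner ℝ w.1 p.2 + inner ℝ p.1 w.2 = 0}

/-- The standard form `∑ᵢ duᵢ ∧ dvᵢ` on `ℝⁿ⁺¹ × ℝⁿ⁺¹`. Its restriction to `T*Sⁿ` is the standard
exact symplectic form. -/
def symplecticForm {n : ℕ} (w w' : E n × E n) : ℝ :=
  inner ℝ w.1 w'.2 - inner ℝ w.2 w'.1

/-- `ξ` is the value at `p ∈ T*Sⁿ` of the Hamiltonian vector field of (the restriction to `T*Sⁿ`
of) the function `h`, that is, `ξ` is tangent to `T*Sⁿ` and `ω(ξ, ·) = dh` on the tangent space. -/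
def IsHamiltonianVector {n : ℕ} (h : E n × E n → ℝ) (p ξ : E n × E n) : Prop :=
  ξ ∈ tangentSet p ∧ ∀ w ∈ tangentSet p, symplecticForm ξ w = fderiv ℝ h p w

/-- `γ` is a flow line of the Hamiltonian flow of `ρ(μ)`, with `μ(u, v) = ‖v‖`, on the complement
of the zero section in `T*Sⁿ`. -/
def IsFlowLine {n : ℕ} (ρ : ℝ → ℝ) (γ : ℝ → CotangentSphere n) : Prop :=
  ∀ t : ℝ, (γ t).1.2 ≠ 0 ∧ ∃ ξ : E n × E n, HasDerivAt (fun s => (γ s).1) ξ t ∧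
    IsHamiltonianVector (fun p => ρ ‖p.2‖) (γ t).1 ξ

/-- The functions `ρ` that are used to define the Dehn twist: `ρ` is smooth, `ρ(t) = 0` for
sufficiently large `t`, and `ρ(-t) = ρ(t) - t` for small `|t|`. -/
def IsTwistProfile (ρ : ℝ → ℝ) : Prop :=
  ContDiff ℝ ∞ ρ ∧ (∃ T : ℝ, ∀ t ≥ T, ρ t = 0) ∧
    ∃ ε > 0, ∀ t : ℝ, |t| < ε → ρ (-t) = ρ t - t

/-- `τ` is the Dehn twist defined with `ρ`: the compactly supported diffeomorphism of `T*Sⁿ` that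
agrees off the zero section with the time `2π` map of the Hamiltonian flow of `ρ(μ)`. -/
def IsDehnTwist {n : ℕ} (ρ : ℝ → ℝ) (τ : DiffC n) : Prop :=
  ∀ x : CotangentSphere n, x.1.2 ≠ 0 →
    ∃ γ : ℝ → CotangentSphere n, IsFlowLine ρ γ ∧ γ 0 = x ∧
      γ (2 * Real.pi) = (τ : Equiv.Perm (CotangentSphere n)) x

/-! ### Cross products and rotations -/

/-- A cross product on `ℝⁿ⁺¹`: a bilinear map such that `a × b` is orthogonal to `a` and to `b`
and `|a × b|² = |a|²|b|² - ⟨a, b⟩²`. -/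
def IsCrossProduct {n : ℕ} (B : E n →ₗ[ℝ] E n →ₗ[ℝ] E n) : Prop :=
  ∀ a b : E n, inner ℝ (B a b) a = 0 ∧ inner ℝ (B a b) b = 0 ∧
    ‖B a b‖ ^ 2 = ‖a‖ ^ 2 * ‖b‖ ^ 2 - (inner ℝ a b) ^ 2

/-- The rotation by the angle `θ` in the plane with oriented orthonormal basis `(e, f)`, equal to
the identity on the orthogonal complement of that plane. -/
def planeRotation {n : ℕ} (θ : ℝ) (e f x : E n) : E n :=
  x + (Real.cos θ - 1) • (inner ℝ e x • e + inner ℝ f x • f)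
    + Real.sin θ • (inner ℝ e x • f - inner ℝ f x • e)

/-- The normalisation `a / |a|` of a nonzero vector. -/
def unitVec {n : ℕ} (a : E n) : E n := ‖a‖⁻¹ • a

/-- `R^θ_{(a,b)}` for linearly independent `a, b`: the rotation by the angle `θ` in the plane
spanned by `a` and `b`, oriented by `(a, b)`. An oriented orthonormal basis of the plane is obtained
from `(a, b)` by the Gram-Schmidt process. -/
def rotation {n : ℕ} (θ : ℝ) (a b x : E n) : E n :=
  planeRotation θ (unitVec a) (unitVec (b - inner ℝ (unitVec a) b • unitVec a)) x

open Classical in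
/-- The map `(u, v) ↦ R^{θ(|v|)}_{((1 - t) u + t u × v, v)} (u, v)` if `v ≠ 0`, and
`(u, v) ↦ (u, v)` if `v = 0`, the rotation being applied to each vector separately. -/
def crossTwist {n : ℕ} (B : E n →ₗ[ℝ] E n →ₗ[ℝ] E n) (θ : ℝ → ℝ) (t : ℝ) (p : E n × E n) :
    E n × E n :=
  if p.2 = 0 then p else
    (rotation (θ ‖p.2‖) ((1 - t) • p.1 + t • B p.1 p.2) p.2 p.1,
     rotation (θ ‖p.2‖) ((1 - t) • p.1 + t • B p.1 p.2) p.2 p.2)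

end DehnTwist

end

open DehnTwist

namespace DehnTwist

/-! ### Smoothness of radial functions -/

/-! Since `|v|` is preserved, the Hamiltonian flow of `ρ(μ)` rotates `u` and `v` in their common
oriented plane with angular speed `ρ'(|v|)` (`IsFlowLine.eq_geodesicMap`). The symmetry of `ρ` gives
`ρ'(0) = 1/2`, so the time `2π` map turns by an angle tending to `π` at the zero section. Split off
the antipodal map: the remaining angle `2π(ρ'(r) - 1/2)` is odd in `r` near `0`, so its quotient by
`r` is smooth and even there. This extends the map to `τ`, antipodal on the zero section. Rotations
are written as `geodesicMap k`, with angle `k|v|`, which involves only `cos` and `sinc` and is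
smooth across `v = 0` whenever `k` is. Density of the complement of the zero section gives
uniqueness.

The square `τ²` is the rotation by `2π(2ρ' - 1)`, and `S_0` the rotation by `θ`. The total angle of
`S_0 τ²` vanishes for large `|v|` and its quotient by `|v|` is smooth, so scaling it to zero is a
compactly supported isotopy: `[S_0][τ²] = 1`. The cross product then contracts `S_0`. The axis
`(1-t)u + t u×v` stays orthogonal to `v`, and the rotation in the plane of this axis and `v`
commutes with forming `u×v`, hence with forming the axis; so each `S_t` is inverted by the opposite
angle. At `t = 1` the base point is fixed and `v` is rotated in the complex structure `u×` of the
fibre. That formula is smooth for any angle at `v = 0`, so the angle can be deformed to the constant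
`2π`.

An isotopy from `τ` to the identity, restricted to the zero section and projected to the sphere,
would be a smooth homotopy from the antipodal map of an even-dimensional sphere to the identity.
`not_exists_homotopy_antipodal` excludes this by a volume argument in place of degree theory: a `C¹`
self-map of an odd-dimensional space that is the identity outside a ball has Jacobian integral equal
to the volume of the ball, yet inserting the homotopy into a shell would change this integral. -/

theorem contDiff_moment_nat (n : ℕ) : ∀ (j : ℕ) (f : ℝ → ℝ), ContDiff ℝ ∞ f →
    ContDiff ℝ n (fun t => ∫ s in (0 : ℝ)..1, s ^ j * f (s * t)) := by
  induction n with
  | zero =>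
    intro j f hf
    have hc := hf.continuous
    refine contDiff_zero.2 (intervalIntegral.continuous_parametric_intervalIntegral_of_continuous'
      (by fun_prop) 0 1)
  | succ n ih =>
    intro j f hf
    have hf' : ContDiff ℝ ∞ (deriv f) := (contDiff_infty_iff_deriv.1 hf).2
    -- Differentiating under the integral raises the weight by one power of `s`; the exponent `j` is
    -- there to make the induction close.
    have key : ∀ t, HasDerivAt (fun t => ∫ s in (0 : ℝ)..1, s ^ j * f (s * t))
        (∫ s in (0 : ℝ)..1, s ^ (j + 1) * deriv f (s * t)) t := by
      intro t
      have hc := hf.continuous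
      have hc' := hf'.continuous
      obtain ⟨C, hC⟩ := (isCompact_Icc (a := -(|t| + 1)) (b := |t| + 1)).exists_bound_of_continuousOn
        hc'.continuousOn
      refine (intervalIntegral.hasDerivAt_integral_of_dominated_loc_of_deriv_le
        (F' := fun x s => s ^ (j + 1) * deriv f (s * x)) (bound := fun _ => C)
        (Metric.ball_mem_nhds t one_pos) ?_ ?_ ?_ ?_ ?_ ?_).2
      · exact Filter.Eventually.of_forall fun x =>
          Continuous.aestronglyMeasurable (by fun_prop)
      · exact Continuous.intervalIntegrable (by fun_prop) _ _
      · exact Continuous.aestronglyMeasurable (by fun_prop)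
      · refine Filter.Eventually.of_forall fun s hs x hx => ?_
        rw [Set.uIoc_of_le zero_le_one] at hs
        have hx' : |x| ≤ |t| + 1 := by
          have h1 := Metric.mem_ball.1 hx
          rw [Real.dist_eq] at h1
          have := abs_sub_abs_le_abs_sub x t
          linarith
        have hsx : |s * x| ≤ |t| + 1 := by
          rw [abs_mul, abs_of_pos hs.1]
          calc s * |x| ≤ 1 * |x| := by gcongr; exact hs.2
            _ ≤ |t| + 1 := by linarith
        have h2 := hC (s * x) (abs_le.1 hsx)
        rw [norm_mul, norm_pow, Real.norm_of_nonneg hs.1.le]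
        calc s ^ (j + 1) * ‖deriv f (s * x)‖ ≤ 1 * ‖deriv f (s * x)‖ := by
              gcongr; exact pow_le_one₀ hs.1.le hs.2
          _ ≤ C := by linarith
      · exact intervalIntegrable_const
      · refine Filter.Eventually.of_forall fun s _ x _ => ?_
        have h1 : HasDerivAt (fun x => s * x) s x := by
          simpa using (hasDerivAt_id x).const_mul s
        have h2 := ((hf.differentiable (by simp)) (s * x)).hasDerivAt.comp x h1
        exact (h2.const_mul (s ^ j)).congr_deriv (by ring)
    push_cast
    refine contDiff_succ_iff_deriv.2 ⟨fun t => (key t).differentiableAt, by simp, ?_⟩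
    rw [show deriv (fun t => ∫ s in (0 : ℝ)..1, s ^ j * f (s * t)) =
      fun t => ∫ s in (0 : ℝ)..1, s ^ (j + 1) * deriv f (s * t) from funext fun t => (key t).deriv]
    exact ih (j + 1) (deriv f) hf'

/-- The average of `f` over the segment from `0` to `t`. -/
noncomputable def segmentAverage (f : ℝ → ℝ) (t : ℝ) : ℝ := ∫ s in (0 : ℝ)..1, f (s * t)

theorem contDiff_segmentAverage {f : ℝ → ℝ} (hf : ContDiff ℝ ∞ f) :
    ContDiff ℝ ∞ (segmentAverage f) :=
  contDiff_infty.2 fun n => by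
    have h := contDiff_moment_nat n 0 f hf
    simp only [pow_zero, one_mul] at h
    exact h

theorem mul_segmentAverage_deriv {f : ℝ → ℝ} (hf : ContDiff ℝ ∞ f) (t : ℝ) :
    t * segmentAverage (deriv f) t = f t - f 0 := by
  have hf' : ContDiff ℝ ∞ (deriv f) := (contDiff_infty_iff_deriv.1 hf).2
  have h := intervalIntegral.mul_integral_comp_mul_right (f := deriv f) (a := 0) (b := 1) t
  rw [segmentAverage, h, zero_mul, one_mul]
  exact intervalIntegral.integral_deriv_eq_sub
    (fun x _ => hf.differentiable (by simp) x) (hf'.continuous.intervalIntegrable _ _)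

theorem segmentAverage_neg {f : ℝ → ℝ} {ε : ℝ} (hf : ∀ t : ℝ, |t| < ε → f (-t) = f t)
    (t : ℝ) (ht : |t| < ε) : segmentAverage f (-t) = segmentAverage f t := by
  refine intervalIntegral.integral_congr fun s hs => ?_
  rw [Set.uIcc_of_le zero_le_one] at hs
  simp only [mul_neg]
  refine hf _ (lt_of_le_of_lt ?_ ht)
  rw [abs_mul, abs_of_nonneg hs.1]
  exact mul_le_of_le_one_left (abs_nonneg t) hs.2

/-- If `f` is even (odd) near `0`, then its derivative is odd (even) near `0`. -/
theorem deriv_neg_of_parity {f : ℝ → ℝ} {ε c : ℝ} (hf : ∀ t : ℝ, |t| < ε → f (-t) = c * f t)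
    (t : ℝ) (ht : |t| < ε) : deriv f (-t) = -(c * deriv f t) := by
  have h : (fun x => f (-x)) =ᶠ[nhds t] fun x => c * f x := by
    filter_upwards [(isOpen_lt continuous_abs continuous_const).mem_nhds ht] with x hx
    exact hf x hx
  have h1 := h.deriv_eq
  rw [deriv_comp_neg, deriv_const_mul_field] at h1
  linarith

section Radial

variable {V : Type*} [NormedAddCommGroup V] [InnerProductSpace ℝ V]

theorem hasFDerivAt_norm_of_ne_zero {v : V} (hv : v ≠ 0) :
    HasFDerivAt (fun v : V => ‖v‖) (‖v‖⁻¹ • innerSL ℝ v) v := by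
  have h := (hasStrictFDerivAt_norm_sq v).hasFDerivAt.sqrt (by simpa using hv)
  simp only [Real.sqrt_sq (norm_nonneg _)] at h
  refine h.congr_fderiv ?_
  ext w
  simp
  field_simp

/-- The derivative at `v` is `(f'(r)/r) ⟨v, ·⟩` with `r = ‖v‖`. As `f'` is odd near `0`, the
quotient `f'(r)/r` is the average of `f''` over `[0, r]`, which is again smooth and even near `0`,
so the induction applies to it. -/
theorem contDiff_comp_norm_nat (n : ℕ) : ∀ f : ℝ → ℝ, ContDiff ℝ ∞ f →
    (∃ ε > 0, ∀ t : ℝ, |t| < ε → f (-t) = f t) → ContDiff ℝ n (fun v : V => f ‖v‖) := by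
  induction n with
  | zero => exact fun f hf _ => contDiff_zero.2 (hf.continuous.comp continuous_norm)
  | succ n ih =>
    rintro f hf ⟨ε, hε, heven⟩
    have hf' : ContDiff ℝ ∞ (deriv f) := (contDiff_infty_iff_deriv.1 hf).2
    have hf'' : ContDiff ℝ ∞ (deriv (deriv f)) := (contDiff_infty_iff_deriv.1 hf').2
    have hodd : ∀ t : ℝ, |t| < ε → deriv f (-t) = (-1) * deriv f t := fun t ht => by
      rw [deriv_neg_of_parity (c := 1) (by simpa using heven) t ht]; ring
    have heven' : ∀ t : ℝ, |t| < ε → deriv (deriv f) (-t) = deriv (deriv f) t := fun t ht => by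
      rw [deriv_neg_of_parity hodd t ht]; ring
    have hzero : deriv f 0 = 0 := by
      have := hodd 0 (by simpa using hε)
      rw [neg_zero] at this
      linarith
    have hmul : ∀ t, t * segmentAverage (deriv (deriv f)) t = deriv f t := fun t => by
      rw [mul_segmentAverage_deriv hf', hzero, sub_zero]
    have key : ∀ v : V, HasFDerivAt (fun v : V => f ‖v‖)
        (segmentAverage (deriv (deriv f)) ‖v‖ • innerSL ℝ v) v := by
      intro v
      -- At the origin `f'(0) = 0` makes `f ‖v‖ - f 0` of order `o(‖v‖)`.
      rcases eq_or_ne v 0 with rfl | hv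
      · have h1 : HasDerivAt f 0 0 := by
          simpa [hzero] using (hf.differentiable (by simp) 0).hasDerivAt
        rw [map_zero, smul_zero]
        rw [hasDerivAt_iff_isLittleO] at h1
        rw [hasFDerivAt_iff_isLittleO]
        have h2 : Filter.Tendsto (fun v : V => ‖v‖) (nhds 0) (nhds 0) := tendsto_norm_zero
        exact Asymptotics.IsLittleO.of_norm_right
          (by simpa [Function.comp_def] using h1.comp_tendsto h2)
      · have h1 := (hf.differentiable (by simp) ‖v‖).hasDerivAt.comp_hasFDerivAt v
          (hasFDerivAt_norm_of_ne_zero hv)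
        refine h1.congr_fderiv ?_
        have hv' : ‖v‖ ≠ 0 := norm_ne_zero_iff.2 hv
        rw [← hmul, smul_smul, mul_right_comm, mul_inv_cancel₀ hv', one_mul]
    push_cast
    refine contDiff_succ_iff_hasFDerivAt.2 ⟨_, ?_, key⟩
    exact (ih _ (contDiff_segmentAverage hf'') ⟨ε, hε, segmentAverage_neg heven'⟩).smul
      (innerSL ℝ).contDiff

/-- If `f` is smooth, and even near `0`, then `v ↦ f ‖v‖` is smooth. -/
theorem contDiff_comp_norm {f : ℝ → ℝ} (hf : ContDiff ℝ ∞ f)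
    (heven : ∃ ε > 0, ∀ t : ℝ, |t| < ε → f (-t) = f t) : ContDiff ℝ ∞ (fun v : V => f ‖v‖) :=
  contDiff_infty.2 fun n => contDiff_comp_norm_nat n f hf heven

theorem contDiff_cos_norm : ContDiff ℝ ∞ (fun v : V => Real.cos ‖v‖) :=
  contDiff_comp_norm Real.contDiff_cos ⟨1, one_pos, fun t _ => Real.cos_neg t⟩

theorem contDiff_sinc_norm : ContDiff ℝ ∞ (fun v : V => Real.sinc ‖v‖) := by
  have h : Real.sinc = segmentAverage Real.cos := by
    ext t
    rcases eq_or_ne t 0 with rfl | ht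
    · simp [segmentAverage]
    · have h1 := mul_segmentAverage_deriv Real.contDiff_sin t
      rw [Real.deriv_sin, Real.sin_zero, sub_zero] at h1
      rw [Real.sinc_of_ne_zero ht, ← h1]
      field_simp
  rw [h]
  exact contDiff_comp_norm (contDiff_segmentAverage Real.contDiff_cos)
    ⟨1, one_pos, segmentAverage_neg fun t _ => Real.cos_neg t⟩

end Radial

/-! ### The volume integral of a compactly supported perturbation of the identity -/

section Volume

open MeasureTheory Polynomial

variable {V : Type*} [NormedAddCommGroup V] [NormedSpace ℝ V] [FiniteDimensional ℝ V]

/-- `det (1 + A)` is a linear combination, with coefficients independent of `A`, of the numbers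
`det (1 + s A)` for finitely many small `s`. -/
theorem exists_det_one_add_eq_sum {δ : ℝ} (hδ : 0 < δ) :
    ∃ (T : Finset ℝ) (w : ℝ → ℝ), (∀ s ∈ T, 0 ≤ s ∧ s < δ) ∧
      ∀ A : V →L[ℝ] V, (1 + A).det = ∑ s ∈ T, w s * (1 + s • A).det := by
  classical
  let d := Module.finrank ℝ V
  obtain ⟨T, hT, hcard⟩ := (Set.Ico_infinite hδ).exists_subset_card_eq (d + 1)
  -- `s ↦ det (1 + s A)` is a polynomial of degree at most `d`, so `d + 1` nodes determine its value
  -- at `1` by Lagrange interpolation, with weights that do not see `A`.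
  refine ⟨T, fun s => (Lagrange.basis T id s).eval 1, fun s hs => hT hs, fun A => ?_⟩
  let b := Module.finBasis ℝ V
  let M := LinearMap.toMatrix b b (A : V →ₗ[ℝ] V)
  let p : ℝ[X] := Matrix.det ((X : ℝ[X]) • M.map C + (1 : Matrix _ _ ℝ).map C)
  have hp : ∀ s : ℝ, p.eval s = (1 + s • A).det := by
    intro s
    have h1 : p.eval s = (s • M + 1).det := by
      change (evalRingHom s) (Matrix.det _) = _
      rw [RingHom.map_det]
      congr 1
      ext i j
      simp [Matrix.one_apply]
      split_ifs <;> simp [mul_comm]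
    rw [h1, ContinuousLinearMap.det, ← LinearMap.det_toMatrix b]
    congr 1
    simp [M, add_comm, LinearMap.toMatrix_one]
  have hdeg : p.degree < T.card := by
    rw [hcard]
    refine lt_of_le_of_lt degree_le_natDegree ?_
    have := natDegree_det_X_add_C_le M 1
    rw [Fintype.card_fin] at this
    exact_mod_cast Nat.lt_succ_of_le this
  have h2 := Lagrange.eq_interpolate (s := T) (v := id) (Set.injOn_id _) hdeg
  have h3 := congrArg (eval 1) h2
  rw [hp, one_smul, Lagrange.interpolate_apply, eval_finsetSum] at h3
  rw [h3]
  refine Finset.sum_congr rfl fun s _ => ?_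
  rw [eval_mul, eval_C, id, hp, mul_comm]

variable [MeasurableSpace V] [BorelSpace V] (μ : Measure V) [μ.IsAddHaarMeasure]

/-- For small `s` the map `x ↦ x + s g(x)` is a bijection that carries the ball onto itself with
positive Jacobian, so the claim is the change of variables formula. -/
theorem integral_det_of_small {g : V → V} (hg : ContDiff ℝ 1 g) {r : ℝ}
    (hr : ∀ x, x ∉ Metric.closedBall (0 : V) r → g x = 0) :
    ∃ δ > 0, ∀ s : ℝ, 0 ≤ s → s < δ →
      ∫ x in Metric.closedBall (0 : V) r, (1 + s • fderiv ℝ g x).det ∂μ =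
        μ.real (Metric.closedBall (0 : V) r) := by
  have hsupp : HasCompactSupport g :=
    HasCompactSupport.intro (isCompact_closedBall (0 : V) r) hr
  have hdg : Continuous (fderiv ℝ g) := hg.continuous_fderiv (by simp)
  obtain ⟨C, hC⟩ := hdg.bounded_above_of_compact_support (hsupp.fderiv ℝ)
  have hC0 : 0 ≤ C := (norm_nonneg _).trans (hC 0)
  have hlip : LipschitzWith C.toNNReal g := by
    refine lipschitzWith_of_nnnorm_fderiv_le (𝕜 := ℝ) (hg.differentiable (by simp)) fun x => ?_
    rw [← NNReal.coe_le_coe, Real.coe_toNNReal C hC0]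
    exact hC x
  have hdet : ∀ᶠ A : V →L[ℝ] V in nhds 1, 0 < A.det := by
    refine ContinuousLinearMap.continuous_det.continuousAt.eventually (lt_mem_nhds ?_)
    simp [ContinuousLinearMap.det]
  obtain ⟨η, hη, hηdet⟩ := Metric.eventually_nhds_iff.1 hdet
  -- The bound `s C < 1` makes the map a Lipschitz perturbation of the identity, hence a
  -- homeomorphism; `s C < η` keeps its derivative where the determinant is positive.
  refine ⟨min η 1 / (C + 1), by positivity, fun s hs0 hs => ?_⟩
  have hsC : s * C < min η 1 := by
    rw [lt_div_iff₀ (by positivity)] at hs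
    nlinarith
  let Φ : V → V := fun x => x + s • g x
  have hΦ' : ∀ x, HasFDerivAt Φ (1 + s • fderiv ℝ g x) x := fun x =>
    (hasFDerivAt_id x).add ((hg.differentiable (by simp) x).hasFDerivAt.const_smul s)
  have happ : ApproximatesLinearOn Φ ((ContinuousLinearEquiv.refl ℝ V : V ≃L[ℝ] V) : V →L[ℝ] V)
      Set.univ (s * C).toNNReal := by
    intro x _ y _
    have h1 := hlip.norm_sub_le x y
    rw [Real.coe_toNNReal C hC0] at h1
    rw [Real.coe_toNNReal _ (by positivity)]
    have h2 : Φ x - Φ y - ((ContinuousLinearEquiv.refl ℝ V : V ≃L[ℝ] V) : V →L[ℝ] V) (x - y)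
        = s • (g x - g y) := by
      simp [Φ, smul_sub]; abel
    rw [h2, norm_smul, Real.norm_of_nonneg hs0, mul_assoc]
    gcongr
  have hc : Subsingleton V ∨ (s * C).toNNReal <
      ‖((ContinuousLinearEquiv.refl ℝ V).symm : V →L[ℝ] V)‖₊⁻¹ := by
    rcases subsingleton_or_nontrivial V with h | h
    · exact Or.inl h
    · right
      rw [← NNReal.coe_lt_coe, Real.coe_toNNReal _ (by positivity)]
      simpa using hsC.trans_le (min_le_right _ _)
  have hinj : Function.Injective Φ := (happ.toHomeomorph Φ hc).injective
  have hsurj : Function.Surjective Φ := (happ.toHomeomorph Φ hc).surjective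
  have hout : ∀ x, x ∉ Metric.closedBall (0 : V) r → Φ x = x := fun x hx => by
    simp [Φ, hr x hx]
  have himage : Φ '' Metric.closedBall (0 : V) r = Metric.closedBall (0 : V) r := by
    refine Set.Subset.antisymm ?_ fun y hy => ?_
    · rintro _ ⟨x, hx, rfl⟩
      by_contra h
      exact h (by rwa [hinj (hout _ h)])
    · obtain ⟨x, rfl⟩ := hsurj y
      by_cases hx : x ∈ Metric.closedBall (0 : V) r
      · exact ⟨x, hx, rfl⟩
      · rw [hout x hx] at hy
        exact absurd hy hx
  have hchange := integral_image_eq_integral_abs_det_fderiv_smul μ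
    (Metric.isClosed_closedBall (x := (0 : V)) (ε := r)).measurableSet
    (fun x _ => (hΦ' x).hasFDerivWithinAt) hinj.injOn (fun _ => (1 : ℝ))
  rw [himage] at hchange
  rw [setIntegral_const, smul_eq_mul, mul_one] at hchange
  rw [hchange]
  refine integral_congr_ae (Filter.Eventually.of_forall fun x => ?_)
  have hpos : 0 < (1 + s • fderiv ℝ g x).det := by
    refine hηdet ?_
    rw [dist_eq_norm, add_sub_cancel_left, norm_smul, Real.norm_of_nonneg hs0]
    calc s * ‖fderiv ℝ g x‖ ≤ s * C := by gcongr; exact hC x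
      _ < η := hsC.trans_le (min_le_left _ _)
  simp [abs_of_pos hpos]

/-- If `G` is smooth, and the identity outside a ball, then the integral of its Jacobian over this
ball is the volume of the ball. -/
theorem integral_det_fderiv_eq_measure_closedBall {G : V → V} (hG : ContDiff ℝ 1 G) {r : ℝ}
    (hr : ∀ x, x ∉ Metric.closedBall (0 : V) r → G x = x) :
    ∫ x in Metric.closedBall (0 : V) r, (fderiv ℝ G x).det ∂μ =
      μ.real (Metric.closedBall (0 : V) r) := by
  have hg : ContDiff ℝ 1 (fun x => G x - x) := hG.sub contDiff_id
  have hdg : Continuous (fderiv ℝ fun x => G x - x) := hg.continuous_fderiv (by simp)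
  obtain ⟨δ, hδ, hsmall⟩ := integral_det_of_small μ hg (r := r)
    (fun x hx => by simp [hr x hx])
  obtain ⟨T, w, hT, hw⟩ := exists_det_one_add_eq_sum (V := V) hδ
  -- No injectivity of `G` is needed: by interpolation its integral is the `w`-weighted sum of the
  -- integrals for small `s`, all equal to the volume, and the weights sum to `1` (take `A = 0`).
  have hone : ∑ s ∈ T, w s = 1 := by
    have := hw 0
    simpa [ContinuousLinearMap.det] using this.symm
  have hfd : ∀ x, (fderiv ℝ G x).det =
      ∑ s ∈ T, w s * (1 + s • fderiv ℝ (fun x => G x - x) x).det := by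
    intro x
    rw [← hw]
    congr 1
    have h : HasFDerivAt (fun x => G x - x) (fderiv ℝ G x - 1) x :=
      (hG.differentiable (by simp) x).hasFDerivAt.sub (hasFDerivAt_id x)
    rw [h.fderiv, add_sub_cancel]
  simp_rw [hfd]
  rw [integral_finsetSum]
  · rw [← one_mul (μ.real _), ← hone, Finset.sum_mul]
    refine Finset.sum_congr rfl fun s hs => ?_
    rw [integral_const_mul, hsmall s (hT s hs).1 (hT s hs).2]
  · intro s _
    refine ContinuousOn.integrableOn_compact (isCompact_closedBall _ _) (Continuous.continuousOn ?_)
    exact continuous_const.mul (ContinuousLinearMap.continuous_det.comp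
      (continuous_const.add (hdg.const_smul s)))

end Volume

/-! ### The antipodal map of an even-dimensional sphere -/

section Antipodal

open MeasureTheory Metric

/-- The radius function of a map of `ℝⁿ⁺¹` that collapses the unit ball to `0` and the shell
`2 ≤ ‖x‖ ≤ 3` to the unit sphere, and is the identity for `4 ≤ ‖x‖`. -/
noncomputable def collapseRadius (r : ℝ) : ℝ :=
  Real.smoothTransition (r - 1) + (r - 1) * Real.smoothTransition (r - 3)

theorem contDiff_collapseRadius : ContDiff ℝ ∞ collapseRadius := by
  unfold collapseRadius
  have h := Real.smoothTransition.contDiff (n := ⊤)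
  fun_prop

theorem collapseRadius_of_le_one {r : ℝ} (hr : r ≤ 1) : collapseRadius r = 0 := by
  rw [collapseRadius, Real.smoothTransition.zero_of_nonpos (by linarith),
    Real.smoothTransition.zero_of_nonpos (by linarith)]
  ring

theorem collapseRadius_of_le_three {r : ℝ} (hr : r ≤ 3) :
    collapseRadius r = Real.smoothTransition (r - 1) := by
  rw [collapseRadius, Real.smoothTransition.zero_of_nonpos (x := r - 3) (by linarith)]
  ring

theorem collapseRadius_shell {r : ℝ} (hr : 2 ≤ r) (hr' : r ≤ 3) : collapseRadius r = 1 := by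
  rw [collapseRadius_of_le_three hr', Real.smoothTransition.one_of_one_le (by linarith)]

theorem collapseRadius_of_four_le {r : ℝ} (hr : 4 ≤ r) : collapseRadius r = r := by
  rw [collapseRadius, Real.smoothTransition.one_of_one_le (by linarith),
    Real.smoothTransition.one_of_one_le (by linarith)]
  ring

theorem deriv_collapseRadius_nonneg {r : ℝ} (hr : r < 3) : 0 ≤ deriv collapseRadius r := by
  have h : collapseRadius =ᶠ[nhds r] fun r => Real.smoothTransition (r - 1) := by
    filter_upwards [Iio_mem_nhds hr] with x hx
    exact collapseRadius_of_le_three (le_of_lt hx)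
  rw [h.deriv_eq]
  refine Monotone.deriv_nonneg ?_
  exact fun x y hxy => Real.smoothTransition.monotone (by linarith)

theorem exists_deriv_collapseRadius_pos :
    ∃ r, 1 < r ∧ r < 2 ∧ 0 < collapseRadius r ∧ 0 < deriv collapseRadius r := by
  obtain ⟨r, hr, hr'⟩ := exists_deriv_eq_slope collapseRadius (a := 1) (b := 2) (by norm_num)
    contDiff_collapseRadius.continuous.continuousOn
    (contDiff_collapseRadius.differentiable (by simp)).differentiableOn
  rw [collapseRadius_shell le_rfl (by norm_num), collapseRadius_of_le_one le_rfl] at hr'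
  refine ⟨r, hr.1, hr.2, ?_, by rw [hr']; norm_num⟩
  rw [collapseRadius_of_le_three (by linarith [hr.2])]
  exact Real.smoothTransition.pos_of_pos (by linarith [hr.1])

variable {V : Type*} [NormedAddCommGroup V] [InnerProductSpace ℝ V] [FiniteDimensional ℝ V]

/-- The map is `c` times the transvection `w ↦ w + f(w) c⁻¹ v`, whose determinant is `1 + c⁻¹ f(v)`.
-/
theorem det_smul_add_smulRight (c : ℝ) (hc : c ≠ 0) (f : V →L[ℝ] ℝ) (v : V) :
    (c • (1 : V →L[ℝ] V) + f.smulRight v).det = c ^ Module.finrank ℝ V * (1 + c⁻¹ * f v) := by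
  have h : ((c • (1 : V →L[ℝ] V) + f.smulRight v : V →L[ℝ] V) : V →ₗ[ℝ] V) =
      c • LinearMap.transvection (f : V →ₗ[ℝ] ℝ) (c⁻¹ • v) := by
    ext w
    simp [LinearMap.transvection.apply, smul_smul]
    rw [mul_left_comm, mul_inv_cancel₀ hc, mul_one]
  rw [ContinuousLinearMap.det, h, LinearMap.det_smul, LinearMap.transvection.det]
  simp

/-- The determinant of the derivative of a radial map. -/
theorem det_fderiv_radial {b : ℝ → ℝ} {x : V} (hx : x ≠ 0) (hb : DifferentiableAt ℝ b ‖x‖)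
    (hbx : b ‖x‖ ≠ 0) :
    (fderiv ℝ (fun x : V => b ‖x‖ • ‖x‖⁻¹ • x) x).det =
      (b ‖x‖ / ‖x‖) ^ Module.finrank ℝ V * (deriv b ‖x‖ * ‖x‖ / b ‖x‖) := by
  have hx' : ‖x‖ ≠ 0 := norm_ne_zero_iff.2 hx
  have hq : HasDerivAt (fun r => b r * r⁻¹) (deriv b ‖x‖ * ‖x‖⁻¹ + b ‖x‖ * (-(‖x‖ ^ 2)⁻¹)) ‖x‖ :=
    hb.hasDerivAt.mul (hasDerivAt_inv hx')
  have h := (hq.comp_hasFDerivAt x (hasFDerivAt_norm_of_ne_zero hx)).smul (hasFDerivAt_id x)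
  have heq : (fun x : V => b ‖x‖ • ‖x‖⁻¹ • x) =
      fun x => ((fun r => b r * r⁻¹) ∘ fun x : V => ‖x‖) x • id x := by
    ext1 x; simp [smul_smul]
  rw [heq]
  erw [h.fderiv]
  have hc : b ‖x‖ * ‖x‖⁻¹ ≠ 0 := mul_ne_zero hbx (inv_ne_zero hx')
  have := det_smul_add_smulRight (b ‖x‖ * ‖x‖⁻¹) hc
    ((deriv b ‖x‖ * ‖x‖⁻¹ + b ‖x‖ * (-(‖x‖ ^ 2)⁻¹)) • ‖x‖⁻¹ • innerSL ℝ x) x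
  refine this.trans ?_
  rw [← div_eq_mul_inv]
  congr 1
  simp
  field_simp
  ring

/-- If the derivative were onto, some `w` would be sent to `G x`, and the locally constant `‖G‖²`
would have derivative `2‖G x‖² = 2` along `w`. -/
theorem det_fderiv_eq_zero_of_eventually_norm_eq_one {G : V → V} {x : V}
    (hG : DifferentiableAt ℝ G x) (h : ∀ᶠ y in nhds x, ‖G y‖ = 1) : (fderiv ℝ G x).det = 0 := by
  by_contra hdet
  have hsurj : Function.Surjective (fderiv ℝ G x) :=
    (LinearMap.equivOfDetNeZero _ hdet).surjective
  obtain ⟨w, hw⟩ := hsurj (G x)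
  have h1 : HasFDerivAt (fun y => ‖G y‖ ^ 2) (2 • (innerSL ℝ (G x)).comp (fderiv ℝ G x)) x :=
    hG.hasFDerivAt.norm_sq
  have h2 : HasFDerivAt (fun y => ‖G y‖ ^ 2) (0 : V →L[ℝ] ℝ) x :=
    (hasFDerivAt_const (1 : ℝ) x).congr_of_eventuallyEq (by
      filter_upwards [h] with y hy
      rw [hy, one_pow])
  have h3 := congrArg (fun A : V →L[ℝ] ℝ => A w) (h1.unique h2)
  have h4 := h.self_of_nhds
  simp [hw, h4] at h3

/-- The antipodal map of the unit sphere in an odd-dimensional Euclidean space is not smoothly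
homotopic to the identity. -/
theorem not_exists_homotopy_antipodal (hodd : Odd (Module.finrank ℝ V))
    (U : unitInterval → V → V) (hU : ∀ t x, ‖x‖ = 1 → ‖U t x‖ = 1)
    (hU0 : ∀ x, ‖x‖ = 1 → U 0 x = -x) (hU1 : ∀ x, ‖x‖ = 1 → U 1 x = x)
    (hsmooth : ∀ (t : unitInterval) (x : V), ‖x‖ = 1 → ∃ W : Set (ℝ × V), IsOpen W ∧
      ((t : ℝ), x) ∈ W ∧ ∃ F : ℝ × V → V, ContDiffOn ℝ ∞ F W ∧
        ∀ (s : unitInterval) (y : V), ‖y‖ = 1 → ((s : ℝ), y) ∈ W → F ((s : ℝ), y) = U s y) :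
    False := by
  borelize V
  -- The homotopy runs for `9/4 ≤ r ≤ 11/4`, strictly inside the shell `2 ≤ r ≤ 3`. The regions
  -- where `G = -P`, where both maps take values in the sphere, and where `G = P` are thus open and
  -- cover the space.
  let σ : ℝ → unitInterval := fun r => ⟨Real.smoothTransition (2 * r - 9 / 2),
    Real.smoothTransition.nonneg _, Real.smoothTransition.le_one _⟩
  have hσ0 : ∀ r : ℝ, r ≤ 9 / 4 → σ r = 0 := fun r hr =>
    Subtype.ext (Real.smoothTransition.zero_of_nonpos (by linarith))
  have hσ1 : ∀ r : ℝ, 11 / 4 ≤ r → σ r = 1 := fun r hr =>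
    Subtype.ext (Real.smoothTransition.one_of_one_le (by linarith))
  have hunit : ∀ x : V, x ≠ 0 → ‖‖x‖⁻¹ • x‖ = 1 := fun x hx => by
    rw [norm_smul, norm_inv, norm_norm, inv_mul_cancel₀ (norm_ne_zero_iff.2 hx)]
  let P : V → V := fun x => collapseRadius ‖x‖ • ‖x‖⁻¹ • x
  let G : V → V := fun x => collapseRadius ‖x‖ • U (σ ‖x‖) (‖x‖⁻¹ • x)
  have hzero : ∀ K : V → V, (∀ x : V, ‖x‖ < 1 → K x = 0) → ContDiffAt ℝ ∞ K 0 := by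
    intro K hK
    refine (contDiffAt_const (c := (0 : V))).congr_of_eventuallyEq ?_
    filter_upwards [ball_mem_nhds (0 : V) one_pos] with x hx
    exact hK x (by simpa using hx)
  have hPG0 : ∀ (x y : V), ‖x‖ < 1 → collapseRadius ‖x‖ • y = 0 := fun x y hx => by
    rw [collapseRadius_of_le_one hx.le, zero_smul]
  have hrad : ∀ x : V, x ≠ 0 → ContDiffAt ℝ ∞ (fun x : V => collapseRadius ‖x‖) x := fun x hx =>
    contDiff_collapseRadius.contDiffAt.comp x (contDiffAt_norm ℝ hx)
  have hdir : ∀ x : V, x ≠ 0 → ContDiffAt ℝ ∞ (fun x : V => ‖x‖⁻¹ • x) x := fun x hx =>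
    ((contDiffAt_norm ℝ hx).inv (norm_ne_zero_iff.2 hx)).smul contDiffAt_id
  have hP : ContDiff ℝ ∞ P := by
    refine contDiff_iff_contDiffAt.2 fun x => ?_
    rcases eq_or_ne x 0 with rfl | hx
    · exact hzero _ fun x hx => hPG0 x _ hx
    · exact (hrad x hx).smul (hdir x hx)
  have hG : ContDiff ℝ ∞ G := by
    refine contDiff_iff_contDiffAt.2 fun x => ?_
    rcases eq_or_ne x 0 with rfl | hx
    · exact hzero _ fun x hx => hPG0 x _ hx
    · refine (hrad x hx).smul ?_
      obtain ⟨W, hW, hxW, F, hF, hFU⟩ := hsmooth (σ ‖x‖) (‖x‖⁻¹ • x) (hunit x hx)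
      have hσs : ContDiffAt ℝ ∞ (fun x : V => ((σ ‖x‖ : ℝ), ‖x‖⁻¹ • x)) x := by
        refine ContDiffAt.prodMk ?_ (hdir x hx)
        exact Real.smoothTransition.contDiffAt.comp x
          ((contDiffAt_const.mul (contDiffAt_norm ℝ hx)).sub contDiffAt_const)
      refine ((hF.contDiffAt (hW.mem_nhds hxW)).comp x hσs).congr_of_eventuallyEq ?_
      filter_upwards [hσs.continuousAt.preimage_mem_nhds (hW.mem_nhds hxW),
        isOpen_ne.mem_nhds hx] with y hy hy0
      exact (hFU _ _ (hunit y hy0) hy).symm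
  have hPout : ∀ x, x ∉ closedBall (0 : V) 4 → P x = x := fun x hx => by
    have hx' : 4 < ‖x‖ := by simpa using hx
    simp only [P]
    rw [collapseRadius_of_four_le hx'.le, smul_smul, mul_inv_cancel₀ (by linarith), one_smul]
  have hGP : ∀ x : V, 11 / 4 < ‖x‖ → G x = P x := fun x hx => by
    have hx0 : x ≠ 0 := by rintro rfl; norm_num at hx
    simp only [G, P]
    rw [hσ1 _ hx.le, hU1 _ (hunit x hx0)]
  have hGP' : ∀ x : V, ‖x‖ < 9 / 4 → G x = -P x := fun x hx => by
    rcases eq_or_ne x 0 with rfl | hx0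
    · simp [G, P, collapseRadius_of_le_one]
    · simp only [G, P]
      rw [hσ0 _ hx.le, hU0 _ (hunit x hx0), smul_neg]
  have hGout : ∀ x, x ∉ closedBall (0 : V) 4 → G x = x := fun x hx => by
    have hx' : 4 < ‖x‖ := by simpa using hx
    rw [hGP x (by linarith), hPout x hx]
  have hIP := integral_det_fderiv_eq_measure_closedBall (volume : Measure V)
    (hP.of_le (by simp)) hPout
  have hIG := integral_det_fderiv_eq_measure_closedBall (volume : Measure V)
    (hG.of_le (by simp)) hGout
  have hnear : ∀ x : V, ‖x‖ < 9 / 4 → (fderiv ℝ G x).det = -(fderiv ℝ P x).det := by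
    intro x hx
    have h : G =ᶠ[nhds x] fun y => -P y := by
      filter_upwards [(isOpen_lt continuous_norm continuous_const).mem_nhds hx] with y hy
      exact hGP' y hy
    rw [h.fderiv_eq, fderiv_fun_neg, ContinuousLinearMap.det, ContinuousLinearMap.det]
    have := LinearMap.det_smul (-1 : ℝ) (fderiv ℝ P x : V →ₗ[ℝ] V)
    rw [hodd.neg_one_pow, neg_one_smul, neg_one_mul] at this
    exact this
  have hfar : ∀ x : V, 11 / 4 < ‖x‖ → (fderiv ℝ G x).det = (fderiv ℝ P x).det := by
    intro x hx
    have h : G =ᶠ[nhds x] P := by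
      filter_upwards [(isOpen_lt continuous_const continuous_norm).mem_nhds hx] with y hy
      exact hGP y hy
    rw [h.fderiv_eq]
  have hmid : ∀ x : V, 2 < ‖x‖ → ‖x‖ < 3 →
      (fderiv ℝ G x).det = 0 ∧ (fderiv ℝ P x).det = 0 := by
    intro x hx hx'
    have h : ∀ᶠ y : V in nhds x, 2 < ‖y‖ ∧ ‖y‖ < 3 :=
      ((isOpen_lt continuous_const continuous_norm).inter
        (isOpen_lt continuous_norm continuous_const)).mem_nhds ⟨hx, hx'⟩
    constructor
    · refine det_fderiv_eq_zero_of_eventually_norm_eq_one (hG.differentiable (by simp) x) ?_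
      filter_upwards [h] with y hy
      have hy0 : y ≠ 0 := by rintro rfl; norm_num at hy
      simp only [G]
      rw [collapseRadius_shell hy.1.le hy.2.le, one_smul]
      exact hU _ _ (hunit y hy0)
    · refine det_fderiv_eq_zero_of_eventually_norm_eq_one (hP.differentiable (by simp) x) ?_
      filter_upwards [h] with y hy
      have hy0 : y ≠ 0 := by rintro rfl; norm_num at hy
      simp only [P]
      rw [collapseRadius_shell hy.1.le hy.2.le, one_smul]
      exact hunit y hy0
  have hinner : ∀ x : V, x ≠ 0 → collapseRadius ‖x‖ ≠ 0 → (fderiv ℝ P x).det =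
      (collapseRadius ‖x‖ / ‖x‖) ^ Module.finrank ℝ V *
        (deriv collapseRadius ‖x‖ * ‖x‖ / collapseRadius ‖x‖) := fun x hx hx' =>
    det_fderiv_radial hx (contDiff_collapseRadius.differentiable (by simp) _) hx'
  have hcontP : Continuous fun x => (fderiv ℝ P x).det :=
    ContinuousLinearMap.continuous_det.comp (hP.continuous_fderiv (by simp))
  have hcontG : Continuous fun x => (fderiv ℝ G x).det :=
    ContinuousLinearMap.continuous_det.comp (hG.continuous_fderiv (by simp))
  have hpos : ∀ x : V, ‖x‖ < 3 → 0 ≤ (fderiv ℝ P x).det := by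
    intro x hx
    rcases le_or_gt ‖x‖ 1 with hx1 | hx1
    -- On the open unit ball `P` is zero. The radial formula would divide by zero at radius `1`, so
    -- that sphere is reached by continuity.
    · have h : Set.EqOn (fun y => (fderiv ℝ P y).det) (fun _ => 0) (ball 0 1) := by
        intro y hy
        have hy' : P =ᶠ[nhds y] fun _ => 0 := by
          filter_upwards [isOpen_ball.mem_nhds hy] with z hz
          exact hPG0 z _ (by simpa using hz)
        have := LinearMap.det_smul (0 : ℝ) (0 : V →ₗ[ℝ] V)
        rw [zero_smul, zero_pow hodd.pos.ne', zero_mul] at this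
        show (fderiv ℝ P y).det = 0
        rw [hy'.fderiv_eq, fderiv_fun_const]
        exact this
      have h' := h.closure hcontP continuous_const
      rw [closure_ball _ one_ne_zero] at h'
      exact (h' (by simpa using hx1)).ge
    · have hb : 0 < collapseRadius ‖x‖ := by
        rw [collapseRadius_of_le_three hx.le]
        exact Real.smoothTransition.pos_of_pos (by linarith)
      rw [hinner x (by rintro rfl; norm_num at hx1) hb.ne']
      have h2 := deriv_collapseRadius_nonneg hx
      positivity
  -- `D` is twice the Jacobian of `P` for `r < 9/4`, because the odd dimension gives `det (-A) =
  -- -det A`, and it vanishes elsewhere. It is continuous, nonnegative and somewhere positive, but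
  -- its integral is the difference of two equal volumes.
  let D : V → ℝ := fun x => (fderiv ℝ P x).det - (fderiv ℝ G x).det
  have hDcont : Continuous D := hcontP.sub hcontG
  have hDout : ∀ x, x ∉ closedBall (0 : V) 4 → D x = 0 := fun x hx => by
    have hx' : 4 < ‖x‖ := by simpa using hx
    simp only [D]
    rw [hfar x (by linarith), sub_self]
  have hDnonneg : 0 ≤ D := by
    intro x
    simp only [Pi.zero_apply, D]
    rcases lt_or_ge ‖x‖ (9 / 4) with h | h
    · rw [hnear x h]
      linarith [hpos x (by linarith)]
    · rcases lt_or_ge (11 / 4) ‖x‖ with h' | h'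
      · rw [hfar x h', sub_self]
      · obtain ⟨h1, h2⟩ := hmid x (by linarith) (by linarith)
        rw [h1, h2, sub_self]
  have hDint : ∫ x, D x = 0 := by
    rw [← setIntegral_eq_integral_of_forall_compl_eq_zero (s := closedBall (0 : V) 4) hDout]
    simp only [D]
    rw [integral_sub, hIP, hIG, sub_self]
    · exact hcontP.continuousOn.integrableOn_compact (isCompact_closedBall _ _)
    · exact hcontG.continuousOn.integrableOn_compact (isCompact_closedBall _ _)
  have : Nontrivial V := Module.nontrivial_of_finrank_pos (R := ℝ) hodd.pos
  obtain ⟨r, hr1, hr2, hbr, hbr'⟩ := exists_deriv_collapseRadius_pos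
  obtain ⟨x, hx⟩ := exists_norm_eq V (by linarith : (0 : ℝ) ≤ r)
  have hDx : D x ≠ 0 := by
    have hx0 : x ≠ 0 := by rintro rfl; rw [norm_zero] at hx; linarith
    simp only [D]
    rw [hnear x (by linarith), hinner x hx0 (by rw [hx]; exact hbr.ne'), hx]
    have : 0 < r := by linarith
    have : 0 < (collapseRadius r / r) ^ Module.finrank ℝ V *
      (deriv collapseRadius r * r / collapseRadius r) := by positivity
    linarith
  have := hDcont.integral_pos_of_hasCompactSupport_nonneg_nonzero (μ := volume)
    (HasCompactSupport.intro (isCompact_closedBall (0 : V) 4) hDout) hDnonneg hDx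
  linarith

end Antipodal

/-! ### Construction of diffeomorphisms and isotopies -/

theorem IsSmooth.of_contDiff {α β V W : Type*} [NormedAddCommGroup V] [NormedSpace ℝ V]
    [NormedAddCommGroup W] [NormedSpace ℝ W] {i : α → V} {j : β → W} {f : α → β} {F : V → W}
    (hF : ContDiff ℝ ∞ F) (h : ∀ x, F (i x) = j (f x)) : IsSmooth i j f :=
  fun _ => ⟨Set.univ, isOpen_univ, trivial, F, hF.contDiffOn, fun x _ => h x⟩

theorem IsSmooth.continuous {n : ℕ} {f : CotangentSphere n → CotangentSphere n}
    (hf : IsSmooth (incl n) (incl n) f) : Continuous f := by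
  rw [continuous_induced_rng, continuous_iff_continuousAt]
  intro x
  obtain ⟨U, hU, hx, F, hF, hFf⟩ := hf x
  have h1 : ContinuousAt (F ∘ Subtype.val) x :=
    (hF.continuousOn.continuousAt (hU.mem_nhds hx)).comp continuous_subtype_val.continuousAt
  refine h1.congr ?_
  filter_upwards [(hU.preimage continuous_subtype_val).mem_nhds hx] with y hy
  exact hFf y hy

theorem isSmooth_section {n : ℕ} (t : unitInterval) :
    IsSmooth (incl n) (inclI n) (fun x => (t, x)) :=
  IsSmooth.of_contDiff (F := fun y => ((t : ℝ), y)) (contDiff_const.prodMk contDiff_id) fun _ => rfl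

theorem isCompact_norm_le (n : ℕ) (R : ℝ) : IsCompact {x : CotangentSphere n | ‖x.1.2‖ ≤ R} := by
  have hclosed : IsClosed {p : E n × E n | ‖p.1‖ = 1 ∧ inner ℝ p.1 p.2 = 0} :=
    (isClosed_eq (by fun_prop) (by fun_prop)).inter (isClosed_eq (by fun_prop) (by fun_prop))
  have h := hclosed.isClosedEmbedding_subtypeVal.isCompact_preimage
    ((isCompact_closedBall (0 : E n) 1).prod (isCompact_closedBall (0 : E n) R))
  have heq : {x : CotangentSphere n | ‖x.1.2‖ ≤ R} =
      Subtype.val ⁻¹' Metric.closedBall (0 : E n) 1 ×ˢ Metric.closedBall (0 : E n) R := by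
    ext x
    have := x.2.1
    simp [this]
  rw [heq]
  exact h

/-- A smooth family of self-maps of `T*Sⁿ` which has a smooth family of inverses, and is the
identity outside a disc bundle, is an isotopy. -/
theorem exists_isIsotopy {n : ℕ} (f g : unitInterval → CotangentSphere n → CotangentSphere n)
    (hgf : ∀ t x, g t (f t x) = x) (hfg : ∀ t x, f t (g t x) = x)
    (hf : IsSmooth (inclI n) (incl n) (fun q => f q.1 q.2))
    (hg : IsSmooth (inclI n) (incl n) (fun q => g q.1 q.2))
    (R : ℝ) (hR : ∀ t x, R < ‖x.1.2‖ → f t x = x) :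
    ∃ H : unitInterval → DiffC n, IsIsotopy H ∧
      ∀ t x, (H t : Equiv.Perm (CotangentSphere n)) x = f t x := by
  have hK : ∀ t, ∀ x ∉ {x : CotangentSphere n | ‖x.1.2‖ ≤ R}, f t x = x := fun t x hx =>
    hR t x (by simpa using hx)
  refine ⟨fun t => ⟨⟨f t, g t, hgf t, hfg t⟩, hf.comp (isSmooth_section t),
    hg.comp (isSmooth_section t), _, isCompact_norm_le n R, hK t⟩, ⟨hf, hg, _,
    isCompact_norm_le n R, hK⟩, fun _ _ => rfl⟩

theorem isotopyClass_eq_of_isIsotopy {n : ℕ} {H : unitInterval → DiffC n} (hH : IsIsotopy H) :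
    isotopyClass (H 0) = isotopyClass (H 1) := by
  refine (QuotientGroup.eq.2 ?_).symm
  exact ⟨fun t => (H 1)⁻¹ * H t, (IsIsotopy.const _).mul hH, rfl, inv_mul_cancel _⟩

theorem isotopyClass_eq_one_iff {n : ℕ} {f : DiffC n} :
    isotopyClass f = 1 ↔ f ∈ isotopicToId n :=
  QuotientGroup.eq_one_iff f

theorem DiffC.ext {n : ℕ} {f g : DiffC n}
    (h : ∀ x, ((f : Equiv.Perm (CotangentSphere n)) x).1 =
      ((g : Equiv.Perm (CotangentSphere n)) x).1) : f = g :=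
  Subtype.ext (Equiv.ext fun x => Subtype.ext (h x))

/-! ### Rotations in the plane of position and momentum -/

section GeodesicMap

variable {n : ℕ}

theorem mul_sinc (x : ℝ) : x * Real.sinc x = Real.sin x := by
  rcases eq_or_ne x 0 with rfl | hx
  · simp
  · rw [Real.sinc_of_ne_zero hx]
    field_simp

/-- The rotation of `u` and `v` by the angle `k ‖v‖` in the plane oriented by `(u, v)`, for
`(u, v) ∈ T*Sⁿ`. -/
noncomputable def geodesicMap (k : ℝ) (p : E n × E n) : E n × E n :=
  (Real.cos (k * ‖p.2‖) • p.1 + (k * Real.sinc (k * ‖p.2‖)) • p.2,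
    Real.cos (k * ‖p.2‖) • p.2 - (k * Real.sinc (k * ‖p.2‖) * ‖p.2‖ ^ 2) • p.1)

/-- Both `cos` and `sinc` are even, so their values at `k ‖v‖` are those at `‖k v‖`, which depend
smoothly on `(k, v)` even at `v = 0`. -/
theorem contDiff_geodesicMap : ContDiff ℝ ∞ (fun q : ℝ × (E n × E n) => geodesicMap q.1 q.2) := by
  have hv : ContDiff ℝ ∞ (fun q : ℝ × (E n × E n) => q.1 • q.2.2) :=
    contDiff_fst.smul contDiff_snd.snd
  have hcos : ContDiff ℝ ∞ (fun q : ℝ × (E n × E n) => Real.cos (q.1 * ‖q.2.2‖)) := by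
    convert contDiff_cos_norm.comp hv using 2 with q
    simp only [Function.comp_apply, norm_smul, Real.norm_eq_abs]
    rw [← Real.cos_abs, abs_mul, abs_norm]
  have hsinc : ContDiff ℝ ∞ (fun q : ℝ × (E n × E n) => Real.sinc (q.1 * ‖q.2.2‖)) := by
    convert contDiff_sinc_norm.comp hv using 2 with q
    simp only [Function.comp_apply, norm_smul, Real.norm_eq_abs]
    rcases abs_cases q.1 with h | h <;> rw [h.1]
    rw [neg_mul, Real.sinc_neg]
  have hnorm : ContDiff ℝ ∞ (fun q : ℝ × (E n × E n) => ‖q.2.2‖ ^ 2) := contDiff_snd.snd.norm_sq ℝ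
  exact ((hcos.smul contDiff_snd.fst).add ((contDiff_fst.mul hsinc).smul contDiff_snd.snd)).prodMk
    ((hcos.smul contDiff_snd.snd).sub
      (((contDiff_fst.mul hsinc).mul hnorm).smul contDiff_snd.fst))

theorem contDiff_geodesicMap_comp {W : Type*} [NormedAddCommGroup W] [NormedSpace ℝ W]
    {c : W → ℝ} {p : W → E n × E n} (hc : ContDiff ℝ ∞ c) (hp : ContDiff ℝ ∞ p) :
    ContDiff ℝ ∞ (fun x => geodesicMap (c x) (p x)) :=
  ContDiff.comp (g := fun q : ℝ × (E n × E n) => geodesicMap q.1 q.2) (f := fun x => (c x, p x))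
    contDiff_geodesicMap (hc.prodMk hp)

theorem geodesicMap_zero (p : E n × E n) : geodesicMap 0 p = p := by
  simp [geodesicMap]

theorem geodesicMap_of_snd_eq_zero (k : ℝ) {p : E n × E n} (hp : p.2 = 0) :
    geodesicMap k p = p := by
  ext1 <;> simp [geodesicMap, hp]

theorem geodesicMap_neg (k : ℝ) (p : E n × E n) : geodesicMap k (-p) = -geodesicMap k p := by
  ext1
  · simp [geodesicMap]; abel
  · simp [geodesicMap]; abel

theorem geodesicMap_div (φ : ℝ) {p : E n × E n} (hp : p.2 ≠ 0) :
    geodesicMap (φ / ‖p.2‖) p = (Real.cos φ • p.1 + (Real.sin φ / ‖p.2‖) • p.2,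
      Real.cos φ • p.2 - (Real.sin φ * ‖p.2‖) • p.1) := by
  have hm : ‖p.2‖ ≠ 0 := norm_ne_zero_iff.2 hp
  have h1 : φ / ‖p.2‖ * ‖p.2‖ = φ := div_mul_cancel₀ _ hm
  have h2 := mul_sinc φ
  rw [geodesicMap, h1, ← h2]
  congr 3
  · ring
  · field_simp

theorem norm_comb_sq {u v : E n} (huv : inner ℝ u v = 0) (a b : ℝ) :
    ‖a • u + b • v‖ ^ 2 = a ^ 2 * ‖u‖ ^ 2 + b ^ 2 * ‖v‖ ^ 2 := by
  rw [norm_add_sq_real, norm_smul, norm_smul, inner_smul_left, inner_smul_right, huv, mul_pow,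
    mul_pow, Real.norm_eq_abs, Real.norm_eq_abs, sq_abs, sq_abs]
  simp

theorem cos_sq_add_sinc_sq (k m : ℝ) :
    Real.cos (k * m) ^ 2 + (k * Real.sinc (k * m)) ^ 2 * m ^ 2 = 1 := by
  have h := mul_sinc (k * m)
  rw [← Real.cos_sq_add_sin_sq (k * m), ← h]
  ring

theorem norm_geodesicMap_snd (k : ℝ) {p : E n × E n} (hp : ‖p.1‖ = 1 ∧ inner ℝ p.1 p.2 = 0) :
    ‖(geodesicMap k p).2‖ = ‖p.2‖ := by
  refine (sq_eq_sq₀ (norm_nonneg _) (norm_nonneg _)).1 ?_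
  have h := norm_comb_sq (u := p.2) (v := p.1) (by rw [real_inner_comm, hp.2])
    (Real.cos (k * ‖p.2‖)) (-(k * Real.sinc (k * ‖p.2‖) * ‖p.2‖ ^ 2))
  rw [neg_smul, ← sub_eq_add_neg] at h
  rw [geodesicMap, h, hp.1]
  linear_combination ‖p.2‖ ^ 2 * cos_sq_add_sinc_sq k ‖p.2‖

theorem geodesicMap_mem (k : ℝ) {p : E n × E n} (hp : ‖p.1‖ = 1 ∧ inner ℝ p.1 p.2 = 0) :
    ‖(geodesicMap k p).1‖ = 1 ∧ inner ℝ (geodesicMap k p).1 (geodesicMap k p).2 = 0 := by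
  constructor
  · refine (sq_eq_sq₀ (norm_nonneg _) zero_le_one).1 ?_
    rw [geodesicMap, norm_comb_sq hp.2, hp.1]
    linear_combination cos_sq_add_sinc_sq k ‖p.2‖
  · simp only [geodesicMap, inner_add_left, inner_sub_right, inner_smul_left, inner_smul_right,
      real_inner_self_eq_norm_sq, hp.1, hp.2, real_inner_comm p.1 p.2]
    simp
    ring

/-- These are the addition formulas for `cos` and `sin`, used with the same `‖v‖` because the first
map preserves it. The `sin` formula is divided by `‖v‖` to give the one for `k sinc(k‖v‖)`, so `v =
0` is separate. -/
theorem geodesicMap_geodesicMap (k l : ℝ) {p : E n × E n}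
    (hp : ‖p.1‖ = 1 ∧ inner ℝ p.1 p.2 = 0) :
    geodesicMap k (geodesicMap l p) = geodesicMap (k + l) p := by
  have hcos : Real.cos ((k + l) * ‖p.2‖) = Real.cos (k * ‖p.2‖) * Real.cos (l * ‖p.2‖) -
      k * Real.sinc (k * ‖p.2‖) * (l * Real.sinc (l * ‖p.2‖)) * ‖p.2‖ ^ 2 := by
    rw [add_mul, Real.cos_add, ← mul_sinc (k * ‖p.2‖), ← mul_sinc (l * ‖p.2‖)]
    ring
  have hsin : (k + l) * Real.sinc ((k + l) * ‖p.2‖) =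
      Real.cos (k * ‖p.2‖) * (l * Real.sinc (l * ‖p.2‖)) +
        k * Real.sinc (k * ‖p.2‖) * Real.cos (l * ‖p.2‖) := by
    rcases eq_or_ne ‖p.2‖ 0 with h0 | h0
    · simp [h0, add_comm]
    · have h := Real.sin_add (k * ‖p.2‖) (l * ‖p.2‖)
      rw [← add_mul, ← mul_sinc, ← mul_sinc (k * ‖p.2‖), ← mul_sinc (l * ‖p.2‖)] at h
      refine mul_right_cancel₀ h0 ?_
      linear_combination h
  have hm := norm_geodesicMap_snd l hp
  rw [geodesicMap, hm]
  simp only [geodesicMap, hcos, hsin]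
  ext1
  · simp only
    module
  · simp only
    module

/-- The map `geodesicMap` on `T*Sⁿ`. -/
noncomputable def geodesicPoint (k : ℝ) (x : CotangentSphere n) : CotangentSphere n :=
  ⟨geodesicMap k x.1, geodesicMap_mem k x.2⟩

/-- The antipodal map on `T*Sⁿ`. -/
noncomputable def antipode (x : CotangentSphere n) : CotangentSphere n :=
  ⟨-x.1, by simpa using x.2⟩

section Twist

variable {k : ℝ → ℝ}

/-- Compactly supported rotations in the planes `(u, v)` that are the identity on the zero section
are isotopic to the identity. -/
theorem mem_isotopicToId_of_eq_geodesicMap (hk : ContDiff ℝ ∞ (fun v : E n => k ‖v‖)) {R : ℝ}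
    (hR : ∀ r > R, k r = 0) (f : DiffC n)
    (hf : ∀ x, ((f : Equiv.Perm (CotangentSphere n)) x).1 = geodesicMap (k ‖x.1.2‖) x.1) :
    f ∈ isotopicToId n := by
  have hnorm : ∀ (c : ℝ) (x : CotangentSphere n), ‖(geodesicPoint c x).1.2‖ = ‖x.1.2‖ :=
    fun c x => norm_geodesicMap_snd c x.2
  -- The factor `1 - q.1` scales the angle to zero; `ε = 1` gives the isotopy and `ε = -1` its
  -- inverses.
  have hF : ∀ ε : ℝ, ContDiff ℝ ∞ (fun q : ℝ × (E n × E n) =>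
      geodesicMap (ε * ((1 - q.1) * k ‖q.2.2‖)) q.2) := fun ε => by
    have h1 : ContDiff ℝ ∞ (fun q : ℝ × (E n × E n) => k ‖q.2.2‖) := hk.comp contDiff_snd.snd
    have h2 : ContDiff ℝ ∞ (fun q : ℝ × (E n × E n) => ε * ((1 - q.1) * k ‖q.2.2‖)) := by
      exact contDiff_const.mul ((contDiff_const.sub contDiff_fst).mul h1)
    exact contDiff_geodesicMap_comp h2 contDiff_snd
  have hsmooth : ∀ ε : ℝ, IsSmooth (inclI n) (incl n) (fun q : unitInterval × CotangentSphere n =>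
      geodesicPoint (ε * ((1 - (q.1 : ℝ)) * k ‖q.2.1.2‖)) q.2) := fun ε =>
    IsSmooth.of_contDiff (hF ε) fun _ => rfl
  have hinv : ∀ (a b : ℝ), a + b = 0 → ∀ (t : unitInterval) (x : CotangentSphere n),
      geodesicPoint (a * ((1 - (t : ℝ)) *
        k ‖(geodesicPoint (b * ((1 - (t : ℝ)) * k ‖x.1.2‖)) x).1.2‖))
        (geodesicPoint (b * ((1 - (t : ℝ)) * k ‖x.1.2‖)) x) = x := by
    intro a b hab t x
    rw [hnorm]
    refine Subtype.ext ((geodesicMap_geodesicMap _ _ x.2).trans ?_)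
    rw [← add_mul, hab, zero_mul, geodesicMap_zero]
  have hid : ∀ (t : unitInterval) (x : CotangentSphere n), R < ‖x.1.2‖ →
      geodesicPoint (1 * ((1 - (t : ℝ)) * k ‖x.1.2‖)) x = x := by
    intro t x hx
    rw [hR _ hx, mul_zero, mul_zero]
    exact Subtype.ext (geodesicMap_zero _)
  obtain ⟨H, hH, hHf⟩ := exists_isIsotopy
    (fun t x => geodesicPoint (1 * ((1 - (t : ℝ)) * k ‖x.1.2‖)) x)
    (fun t x => geodesicPoint (-1 * ((1 - (t : ℝ)) * k ‖x.1.2‖)) x)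
    (hinv (-1) 1 (by norm_num)) (hinv 1 (-1) (by norm_num)) (hsmooth 1) (hsmooth (-1)) R hid
  have h0 : H 0 = f := DiffC.ext fun x => by
    rw [hHf, hf]
    simp [geodesicPoint]
  have h1 : H 1 = 1 := DiffC.ext fun x => by
    rw [hHf]
    simp [geodesicPoint, geodesicMap_zero]
  exact ⟨H, hH, h0, h1⟩

/-- Rotations in the planes `(u, v)`, composed with the antipodal map. -/
theorem exists_diffC_eq_neg_geodesicMap (hk : ContDiff ℝ ∞ (fun v : E n => k ‖v‖)) {R : ℝ}
    (hR : ∀ x : CotangentSphere n, R < ‖x.1.2‖ → geodesicMap (k ‖x.1.2‖) x.1 = -x.1) :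
    ∃ f : DiffC n,
      ∀ x, ((f : Equiv.Perm (CotangentSphere n)) x).1 = -geodesicMap (k ‖x.1.2‖) x.1 := by
  have hnorm : ∀ (c : ℝ) (x : CotangentSphere n),
      ‖(antipode (geodesicPoint c x)).1.2‖ = ‖x.1.2‖ :=
    fun c x => (norm_neg _).trans (norm_geodesicMap_snd c x.2)
  have hsmooth : ∀ ε : ℝ, IsSmooth (inclI n) (incl n) (fun q : unitInterval × CotangentSphere n =>
      antipode (geodesicPoint (ε * k ‖q.2.1.2‖) q.2)) := fun ε =>
    IsSmooth.of_contDiff (F := fun q => -geodesicMap (ε * k ‖q.2.2‖) q.2)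
      (contDiff_geodesicMap_comp (contDiff_const.mul (hk.comp contDiff_snd.snd))
        contDiff_snd).neg fun _ => rfl
  -- A constant family: only the diffeomorphism `H 0` is wanted. The antipodal map commutes with
  -- `geodesicMap`, so opposite rates give inverses.
  obtain ⟨H, -, hHf⟩ := exists_isIsotopy
    (fun _ x => antipode (geodesicPoint (1 * k ‖x.1.2‖) x))
    (fun _ x => antipode (geodesicPoint (-1 * k ‖x.1.2‖) x))
    (fun t x => Subtype.ext <| by
      simp only [hnorm]
      simp only [geodesicPoint, antipode]
      rw [geodesicMap_neg, neg_neg, geodesicMap_geodesicMap _ _ x.2, ← add_mul]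
      simp [geodesicMap_zero])
    (fun t x => Subtype.ext <| by
      simp only [hnorm]
      simp only [geodesicPoint, antipode]
      rw [geodesicMap_neg, neg_neg, geodesicMap_geodesicMap _ _ x.2, ← add_mul]
      simp [geodesicMap_zero])
    (hsmooth 1) (hsmooth (-1)) R (fun t x hx => Subtype.ext <| by
      simp only [geodesicPoint, antipode, one_mul]
      rw [hR x hx, neg_neg])
  exact ⟨H 0, fun x => by rw [hHf]; simp [geodesicPoint, antipode]⟩

end Twist

end GeodesicMap

/-! ### The Hamiltonian flow -/

section Flow

variable {n : ℕ} {ρ : ℝ → ℝ}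

/-- The Hamiltonian vector field of `ρ(μ)` off the zero section. -/
theorem isHamiltonianVector_iff (hρ : Differentiable ℝ ρ) {p : E n × E n}
    (hp : ‖p.1‖ = 1 ∧ inner ℝ p.1 p.2 = 0) (hv : p.2 ≠ 0) (ξ : E n × E n) :
    IsHamiltonianVector (fun p => ρ ‖p.2‖) p ξ ↔
      ξ = ((deriv ρ ‖p.2‖ / ‖p.2‖) • p.2, -(deriv ρ ‖p.2‖ * ‖p.2‖) • p.1) := by
  have hm : ‖p.2‖ ≠ 0 := norm_ne_zero_iff.2 hv
  have hd : ∀ w : E n × E n, fderiv ℝ (fun p : E n × E n => ρ ‖p.2‖) p w =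
      deriv ρ ‖p.2‖ / ‖p.2‖ * inner ℝ p.2 w.2 := by
    intro w
    have h : HasFDerivAt (fun p : E n × E n => ρ ‖p.2‖) _ p :=
      (hρ ‖p.2‖).hasDerivAt.comp_hasFDerivAt p
        ((hasFDerivAt_norm_of_ne_zero hv).comp p hasFDerivAt_snd)
    rw [h.fderiv]
    simp
    ring
  constructor
  · rintro ⟨⟨h1, h2⟩, hξ⟩
    set η : E n × E n := ξ - ((deriv ρ ‖p.2‖ / ‖p.2‖) • p.2, -(deriv ρ ‖p.2‖ * ‖p.2‖) • p.1) with hη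
    have hη0 : ∀ w ∈ tangentSet p, symplecticForm η w = 0 := by
      intro w hw
      have h3 := hξ w hw
      rw [hd] at h3
      simp only [symplecticForm] at h3
      simp only [symplecticForm, hη, Prod.fst_sub, Prod.snd_sub, inner_sub_left, inner_smul_left,
        hw.1]
      simp
      linarith
    have ht1 : inner ℝ p.1 η.1 = 0 := by
      simp only [hη, Prod.fst_sub, inner_sub_right, inner_smul_right, h1, hp.2]
      simp
    have ht2 : inner ℝ p.1 η.2 + inner ℝ η.1 p.2 = 0 := by
      simp only [hη, Prod.fst_sub, Prod.snd_sub, inner_sub_right, inner_sub_left, inner_smul_right,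
        inner_smul_left, real_inner_self_eq_norm_sq, hp.1]
      have : deriv ρ ‖p.2‖ / ‖p.2‖ * ‖p.2‖ ^ 2 = deriv ρ ‖p.2‖ * ‖p.2‖ := by field_simp
      simp [this]
      linarith
    -- Nondegeneracy of the form on the tangent space. The test vector `(0, η.1)` detects `η.1`;
    -- after that `(η.2, -⟨η.2, v⟩ u)`, whose second entry is chosen for tangency, detects `η.2`.
    have hη1 : η.1 = 0 := by
      have h3 := hη0 (0, η.1) ⟨by simp, by simpa using ht1⟩
      simpa [symplecticForm] using h3
    have hη2 : η.2 = 0 := by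
      rw [hη1, inner_zero_left, add_zero] at ht2
      have h3 := hη0 (η.2, -(inner ℝ η.2 p.2) • p.1)
        ⟨ht2, by simp [inner_smul_right, hp.1]⟩
      simpa [symplecticForm, hη1] using h3
    exact sub_eq_zero.1 (Prod.ext hη1 hη2)
  · rintro rfl
    refine ⟨⟨?_, ?_⟩, fun w hw => ?_⟩
    · simp [inner_smul_right, hp.2]
    · simp only [inner_smul_right, inner_smul_left, real_inner_self_eq_norm_sq, hp.1]
      simp
      field_simp
      ring
    · rw [hd]
      simp only [symplecticForm, inner_smul_left, hw.1]
      simp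

/-- The flow lines of `ρ(μ)` are given by rotations. -/
theorem IsFlowLine.eq_geodesicMap (hρ : Differentiable ℝ ρ) {γ : ℝ → CotangentSphere n}
    (hγ : IsFlowLine ρ γ) (t : ℝ) :
    (γ t).1 = geodesicMap (deriv ρ ‖(γ 0).1.2‖ * t / ‖(γ 0).1.2‖) (γ 0).1 := by
  have hder : ∀ t, HasDerivAt (fun s => (γ s).1)
      ((deriv ρ ‖(γ t).1.2‖ / ‖(γ t).1.2‖) • (γ t).1.2,
        -(deriv ρ ‖(γ t).1.2‖ * ‖(γ t).1.2‖) • (γ t).1.1) t := by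
    intro t
    obtain ⟨hv, ξ, hξ, hH⟩ := hγ t
    rwa [(isHamiltonianVector_iff hρ (γ t).2 hv ξ).1 hH] at hξ
  have hu : ∀ t, HasDerivAt (fun s => (γ s).1.1)
      ((deriv ρ ‖(γ t).1.2‖ / ‖(γ t).1.2‖) • (γ t).1.2) t := fun t => (hder t).fst
  have hv : ∀ t, HasDerivAt (fun s => (γ s).1.2)
      (-(deriv ρ ‖(γ t).1.2‖ * ‖(γ t).1.2‖) • (γ t).1.1) t := fun t => (hder t).snd
  have hnorm : ∀ t, ‖(γ t).1.2‖ = ‖(γ 0).1.2‖ := by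
    have h : ∀ t, HasDerivAt (fun s => ‖(γ s).1.2‖ ^ 2) 0 t := by
      intro t
      refine (hv t).norm_sq.congr_deriv ?_
      rw [inner_smul_right, real_inner_comm, (γ t).2.2]
      simp
    intro t
    have h1 := is_const_of_deriv_eq_zero (fun t => (h t).differentiableAt)
      (fun t => (h t).deriv) t 0
    exact (sq_eq_sq₀ (norm_nonneg _) (norm_nonneg _)).1 h1
  set m := ‖(γ 0).1.2‖ with hm_def
  have hm : m ≠ 0 := norm_ne_zero_iff.2 (hγ 0).1
  set a := deriv ρ m with ha
  simp only [hnorm, ← ha] at hu hv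
  have hat : ∀ t, HasDerivAt (fun s => a * s) a t := fun t => by
    simpa using (hasDerivAt_id t).const_mul a
  have hc : ∀ t, HasDerivAt (fun s => Real.cos (a * s)) (-Real.sin (a * t) * a) t :=
    fun t => (hat t).cos
  have hs : ∀ t, HasDerivAt (fun s => Real.sin (a * s)) (Real.cos (a * t) * a) t :=
    fun t => (hat t).sin
  -- Rotating a flow line back by the angle `a t` gives constant vectors; this proves uniqueness of
  -- the solution directly. `hB` does the same for the momentum.
  have hA : ∀ t, Real.cos (a * t) • (γ t).1.1 - (Real.sin (a * t) / m) • (γ t).1.2 =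
      (γ 0).1.1 := by
    have h : ∀ t, HasDerivAt
        (fun t => Real.cos (a * t) • (γ t).1.1 - (Real.sin (a * t) / m) • (γ t).1.2) 0 t := by
      intro t
      refine (((hc t).smul (hu t)).sub (((hs t).div_const m).smul (hv t))).congr_deriv ?_
      match_scalars
      · field_simp; ring
      · field_simp; ring
    intro t
    have h1 := is_const_of_deriv_eq_zero (fun t => (h t).differentiableAt)
      (fun t => (h t).deriv) t 0
    simpa using h1
  have hB : ∀ t, Real.cos (a * t) • (γ t).1.2 + (Real.sin (a * t) * m) • (γ t).1.1 =
      (γ 0).1.2 := by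
    have h : ∀ t, HasDerivAt
        (fun t => Real.cos (a * t) • (γ t).1.2 + (Real.sin (a * t) * m) • (γ t).1.1) 0 t := by
      intro t
      refine (((hc t).smul (hv t)).add (((hs t).mul_const m).smul (hu t))).congr_deriv ?_
      match_scalars
      · field_simp; ring
      · field_simp; ring
    intro t
    have h1 := is_const_of_deriv_eq_zero (fun t => (h t).differentiableAt)
      (fun t => (h t).deriv) t 0
    simpa using h1
  rw [hm_def, geodesicMap_div _ (hγ 0).1, ← hm_def, ← hA t, ← hB t]
  have hcs := Real.cos_sq_add_sin_sq (a * t)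
  ext1
  · match_scalars
    · field_simp
      linear_combination -hcs
    · field_simp
      ring
  · match_scalars
    · field_simp
      linear_combination -hcs
    · field_simp
      ring

theorem isFlowLine_geodesicPoint (hρ : Differentiable ℝ ρ) (x : CotangentSphere n)
    (hx : x.1.2 ≠ 0) :
    IsFlowLine ρ (fun t => geodesicPoint (deriv ρ ‖x.1.2‖ * t / ‖x.1.2‖) x) := by
  intro t
  have hm : ‖x.1.2‖ ≠ 0 := norm_ne_zero_iff.2 hx
  have hnorm : ‖(geodesicPoint (deriv ρ ‖x.1.2‖ * t / ‖x.1.2‖) x).1.2‖ = ‖x.1.2‖ :=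
    norm_geodesicMap_snd _ x.2
  have hne : (geodesicPoint (deriv ρ ‖x.1.2‖ * t / ‖x.1.2‖) x).1.2 ≠ 0 := by
    rw [← norm_ne_zero_iff, hnorm]
    exact hm
  refine ⟨hne, _, ?_, (isHamiltonianVector_iff hρ (geodesicPoint _ x).2 hne _).2 rfl⟩
  rw [hnorm]
  simp only [geodesicPoint, geodesicMap_div _ hx]
  set a := deriv ρ ‖x.1.2‖
  have hat : HasDerivAt (fun s => a * s) a t := by
    simpa using (hasDerivAt_id t).const_mul a
  have hc : HasDerivAt (fun s => Real.cos (a * s)) (-Real.sin (a * t) * a) t := hat.cos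
  have hs : HasDerivAt (fun s => Real.sin (a * s)) (Real.cos (a * t) * a) t := hat.sin
  refine (((hc.smul_const x.1.1).add ((hs.div_const ‖x.1.2‖).smul_const x.1.2)).prodMk
    ((hc.smul_const x.1.2).sub ((hs.mul_const ‖x.1.2‖).smul_const x.1.1))).congr_deriv ?_
  ext1
  · match_scalars
    · field_simp
    · field_simp
  · match_scalars
    · field_simp
    · field_simp

theorem isDehnTwist_iff (hρ : Differentiable ℝ ρ) (τ : DiffC n) :
    IsDehnTwist ρ τ ↔ ∀ x : CotangentSphere n, x.1.2 ≠ 0 →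
      ((τ : Equiv.Perm (CotangentSphere n)) x).1 =
        geodesicMap (deriv ρ ‖x.1.2‖ * (2 * Real.pi) / ‖x.1.2‖) x.1 := by
  refine forall₂_congr fun x hx => ⟨?_, fun h => ?_⟩
  · rintro ⟨γ, hγ, rfl, hτ⟩
    rw [← hτ]
    exact hγ.eq_geodesicMap hρ _
  · refine ⟨_, isFlowLine_geodesicPoint hρ x hx, ?_, ?_⟩
    · exact Subtype.ext (by simp [geodesicPoint, geodesicMap_zero])
    · exact Subtype.ext h.symm

end Flow

/-! ### Existence and uniqueness of the Dehn twist -/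

section Existence

variable {n : ℕ} {ρ : ℝ → ℝ}

/-- The Dehn twist is the composition of the antipodal map with the rotations by the angle
`twistRate ρ ‖v‖ * ‖v‖ = 2π (ρ'(‖v‖) - 1/2)`. -/
noncomputable def twistRate (ρ : ℝ → ℝ) (r : ℝ) : ℝ :=
  2 * Real.pi * segmentAverage (deriv (deriv ρ)) r

theorem IsTwistProfile.contDiff_deriv (hρ : IsTwistProfile ρ) : ContDiff ℝ ∞ (deriv ρ) :=
  (contDiff_infty_iff_deriv.1 hρ.1).2

theorem IsTwistProfile.deriv_zero (hρ : IsTwistProfile ρ) : deriv ρ 0 = 1 / 2 := by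
  obtain ⟨ε, hε, h⟩ := hρ.2.2
  have hd := hρ.1.differentiable (by simp)
  have h1 : (fun t => ρ (-t)) =ᶠ[nhds 0] fun t => ρ t - t := by
    filter_upwards [Metric.ball_mem_nhds (0 : ℝ) hε] with t ht
    exact h t (by simpa using ht)
  have h2 := h1.deriv_eq
  rw [deriv_comp_neg, deriv_fun_sub (hd 0) differentiableAt_fun_id, deriv_id'', neg_zero] at h2
  linarith

/-- Differentiating `ρ(-t) = ρ(t) - t` shows that `ρ' - 1/2` is odd near `0`, hence `ρ''` and its
segment average are even there. -/
theorem IsTwistProfile.contDiff_twistRate (hρ : IsTwistProfile ρ) :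
    ContDiff ℝ ∞ (fun v : E n => twistRate ρ ‖v‖) := by
  have hd := hρ.1.differentiable (by simp)
  obtain ⟨ε, hε, h⟩ := hρ.2.2
  have hodd : ∀ t : ℝ, |t| < ε → deriv ρ (-t) = 1 - deriv ρ t := by
    intro t ht
    have h1 : (fun t => ρ (-t)) =ᶠ[nhds t] fun t => ρ t - t := by
      filter_upwards [(isOpen_lt continuous_abs continuous_const).mem_nhds ht] with x hx
      exact h x hx
    have h2 := h1.deriv_eq
    rw [deriv_comp_neg, deriv_fun_sub (hd t) differentiableAt_fun_id, deriv_id''] at h2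
    linarith
  have heven : ∀ t : ℝ, |t| < ε → deriv (deriv ρ) (-t) = deriv (deriv ρ) t := by
    intro t ht
    have h1 : (fun t => deriv ρ (-t)) =ᶠ[nhds t] fun t => 1 - deriv ρ t := by
      filter_upwards [(isOpen_lt continuous_abs continuous_const).mem_nhds ht] with x hx
      exact hodd x hx
    have h2 := h1.deriv_eq
    rw [deriv_comp_neg, deriv_const_sub] at h2
    linarith
  exact contDiff_const.mul (contDiff_comp_norm
    (contDiff_segmentAverage (contDiff_infty_iff_deriv.1 hρ.contDiff_deriv).2)
    ⟨ε, hε, segmentAverage_neg heven⟩)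

theorem IsTwistProfile.twistRate_eq (hρ : IsTwistProfile ρ) {r : ℝ} (hr : r ≠ 0) :
    twistRate ρ r = (deriv ρ r * (2 * Real.pi) - Real.pi) / r := by
  have h := mul_segmentAverage_deriv hρ.contDiff_deriv r
  rw [hρ.deriv_zero] at h
  rw [twistRate, eq_div_iff hr]
  linear_combination 2 * Real.pi * h

theorem IsTwistProfile.exists_twistRate_eq (hρ : IsTwistProfile ρ) :
    ∃ T > 0, ∀ r > T, twistRate ρ r = -Real.pi / r := by
  obtain ⟨T, hT⟩ := hρ.2.1
  refine ⟨max T 1, by positivity, fun r hr => ?_⟩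
  have h : ρ =ᶠ[nhds r] fun _ => 0 := by
    filter_upwards [Ioi_mem_nhds ((le_max_left _ _).trans_lt hr)] with x hx
    exact hT x (le_of_lt hx)
  have hr0 : r ≠ 0 := (zero_lt_one.trans ((le_max_right _ _).trans_lt hr)).ne'
  rw [hρ.twistRate_eq hr0, h.deriv_eq, deriv_const]
  ring

theorem IsTwistProfile.neg_geodesicMap_twistRate (hρ : IsTwistProfile ρ) {p : E n × E n}
    (hp : p.2 ≠ 0) : -geodesicMap (twistRate ρ ‖p.2‖) p =
      geodesicMap (deriv ρ ‖p.2‖ * (2 * Real.pi) / ‖p.2‖) p := by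
  rw [hρ.twistRate_eq (norm_ne_zero_iff.2 hp), geodesicMap_div _ hp, geodesicMap_div _ hp,
    Real.cos_sub_pi, Real.sin_sub_pi]
  ext1
  · simp only [Prod.fst_neg]
    module
  · simp only [Prod.snd_neg]
    module

theorem exists_norm_eq_one_inner_eq_zero (hn : 0 < n) (u : E n) :
    ∃ w : E n, ‖w‖ = 1 ∧ inner ℝ u w = 0 := by
  have h1 : 0 < Module.finrank ℝ (ℝ ∙ u)ᗮ := by
    have h2 := Submodule.finrank_add_finrank_orthogonal (ℝ ∙ u)
    rw [finrank_euclideanSpace_fin] at h2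
    have h3 := finrank_span_le_card (R := ℝ) ({u} : Set (E n))
    rw [Set.toFinset_singleton, Finset.card_singleton] at h3
    omega
  have : Nontrivial (ℝ ∙ u)ᗮ := Module.nontrivial_of_finrank_pos h1
  obtain ⟨w, hw⟩ := exists_norm_eq (ℝ ∙ u)ᗮ zero_le_one
  exact ⟨w, hw, Submodule.mem_orthogonal_singleton_iff_inner_right.1 w.2⟩

/-- A diffeomorphism of `T*Sⁿ` is determined by its restriction to the complement of the zero
section. -/
theorem DiffC.ext_of_snd_ne_zero (hn : 0 < n) {f g : DiffC n}
    (h : ∀ x : CotangentSphere n, x.1.2 ≠ 0 →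
      (f : Equiv.Perm (CotangentSphere n)) x = (g : Equiv.Perm (CotangentSphere n)) x) : f = g := by
  refine DiffC.ext fun x => congrArg _ ?_
  by_cases hx : x.1.2 = 0
  · obtain ⟨w, hw, hxw⟩ := exists_norm_eq_one_inner_eq_zero hn x.1.1
    -- A line in the fibre that meets the zero section only at `s = 0`; by continuity the two maps
    -- agree there as well.
    let c : ℝ → CotangentSphere n := fun s =>
      ⟨(x.1.1, s • w), x.2.1, by simp [inner_smul_right, hxw]⟩
    have hc : Continuous c := by
      refine Continuous.subtype_mk ?_ _
      fun_prop
    have h1 := Continuous.ext_on (dense_compl_singleton (0 : ℝ))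
      (f.2.1.continuous.comp hc) (g.2.1.continuous.comp hc)
      fun s hs => h (c s) (smul_ne_zero hs (norm_ne_zero_iff.1 (by rw [hw]; exact one_ne_zero)))
    have h2 : c 0 = x := Subtype.ext (Prod.ext rfl (by simp [c, hx]))
    have h3 := congrFun h1 0
    simp only [Function.comp_apply, h2] at h3
    exact h3
  · exact h x hx

theorem IsTwistProfile.exists_dehnTwist (hn : 0 < n) (hρ : IsTwistProfile ρ) :
    ∃ τ : DiffC n, IsDehnTwist ρ τ ∧ (∀ τ' : DiffC n, IsDehnTwist ρ τ' → τ' = τ) ∧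
      ∀ x, ((τ : Equiv.Perm (CotangentSphere n)) x).1 =
        -geodesicMap (twistRate ρ ‖x.1.2‖) x.1 := by
  have hd := hρ.1.differentiable (by simp)
  obtain ⟨T, hT0, hT⟩ := hρ.exists_twistRate_eq
  obtain ⟨τ, hτ⟩ := exists_diffC_eq_neg_geodesicMap (hρ.contDiff_twistRate (n := n)) (R := T)
    -- For large `|v|` the angle is `-π`, so the rotation is the antipodal map and cancels the sign.
    fun x hx => by
      rw [hT _ hx, geodesicMap_div _ (norm_ne_zero_iff.1 (hT0.trans hx).ne')]
      ext1 <;> simp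
  have hτ' : ∀ x : CotangentSphere n, x.1.2 ≠ 0 → ((τ : Equiv.Perm (CotangentSphere n)) x).1 =
      geodesicMap (deriv ρ ‖x.1.2‖ * (2 * Real.pi) / ‖x.1.2‖) x.1 := fun x hx => by
    rw [hτ, hρ.neg_geodesicMap_twistRate hx]
  refine ⟨τ, (isDehnTwist_iff hd τ).2 hτ', fun τ' h => ?_, hτ⟩
  exact DiffC.ext_of_snd_ne_zero hn fun x hx => Subtype.ext
    (((isDehnTwist_iff hd τ').1 h x hx).trans (hτ' x hx).symm)

end Existence

/-! ### The Dehn twist is not isotopic to the identity -/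

/-- A diffeomorphism of `T*Sⁿ`, `n` even, that is antipodal on the zero section, is not isotopic to
the identity. -/
theorem not_mem_isotopicToId_of_antipodal {n : ℕ} (hn : Even n) {f : DiffC n}
    (hf : ∀ x : CotangentSphere n, x.1.2 = 0 →
      ((f : Equiv.Perm (CotangentSphere n)) x).1 = -x.1) : f ∉ isotopicToId n := by
  rintro ⟨H, ⟨hH, -, -⟩, rfl, hH1⟩
  let z : ∀ x : E n, ‖x‖ = 1 → CotangentSphere n := fun x hx => ⟨(x, 0), hx, by simp⟩
  classical
  -- The isotopy restricted to the zero section and projected to the sphere; the value `0` off the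
  -- sphere plays no role.
  let U : unitInterval → E n → E n := fun t x =>
    if hx : ‖x‖ = 1 then ((H t : Equiv.Perm (CotangentSphere n)) (z x hx)).1.1 else 0
  have hU : ∀ t x (hx : ‖x‖ = 1),
      U t x = ((H t : Equiv.Perm (CotangentSphere n)) (z x hx)).1.1 := fun t x hx => dif_pos hx
  refine not_exists_homotopy_antipodal (V := E n) ?_ U ?_ ?_ ?_ ?_
  · rw [finrank_euclideanSpace_fin]
    exact hn.add_one
  · intro t x hx
    rw [hU t x hx]
    exact (((H t : Equiv.Perm (CotangentSphere n)) (z x hx))).2.1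
  · intro x hx
    rw [hU 0 x hx, hf _ rfl]
    rfl
  · intro x hx
    rw [hU 1 x hx, hH1]
    rfl
  · intro t x hx
    obtain ⟨W, hW, hxW, F, hF, hFH⟩ := hH (t, z x hx)
    let j : ℝ × E n → ℝ × (E n × E n) := fun q => (q.1, (q.2, 0))
    have hj : ContDiff ℝ ∞ j := contDiff_fst.prodMk (contDiff_snd.prodMk contDiff_const)
    refine ⟨j ⁻¹' W, hW.preimage hj.continuous, hxW, fun q => (F (j q)).1,
      contDiff_fst.comp_contDiffOn (hF.comp hj.contDiffOn fun _ h => h), fun s y hy hyW => ?_⟩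
    rw [hU s y hy]
    exact congrArg Prod.fst (hFH (s, z y hy) hyW)

/-! ### Rotations in a plane -/

section Rotation

variable {n : ℕ}

theorem inner_planeRotation {e f : E n} (he : ‖e‖ = 1) (hf : ‖f‖ = 1) (hef : inner ℝ e f = 0)
    (θ : ℝ) (x y : E n) :
    inner ℝ (planeRotation θ e f x) (planeRotation θ e f y) = inner ℝ x y := by
  have hfe : inner ℝ f e = 0 := by rw [real_inner_comm, hef]
  simp only [planeRotation, inner_add_left, inner_add_right, inner_sub_left, inner_sub_right,
    inner_smul_left, inner_smul_right, real_inner_self_eq_norm_sq, he, hf, hef, hfe,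
    real_inner_comm e x, real_inner_comm f x]
  simp
  linear_combination (inner ℝ e x * inner ℝ e y + inner ℝ f x * inner ℝ f y) *
    Real.cos_sq_add_sin_sq θ

theorem planeRotation_left {e f : E n} (he : ‖e‖ = 1) (hef : inner ℝ e f = 0) (θ : ℝ) :
    planeRotation θ e f e = Real.cos θ • e + Real.sin θ • f := by
  rw [planeRotation, real_inner_self_eq_norm_sq, he, real_inner_comm, hef]
  module

theorem planeRotation_right {e f : E n} (hf : ‖f‖ = 1) (hef : inner ℝ e f = 0) (θ : ℝ) :
    planeRotation θ e f f = Real.cos θ • f - Real.sin θ • e := by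
  rw [planeRotation, real_inner_self_eq_norm_sq, hf, hef]
  module

theorem planeRotation_smul (θ : ℝ) (e f : E n) (c : ℝ) (x : E n) :
    planeRotation θ e f (c • x) = c • planeRotation θ e f x := by
  simp only [planeRotation, inner_smul_right]
  module

theorem planeRotation_add (θ : ℝ) (e f x y : E n) :
    planeRotation θ e f (x + y) = planeRotation θ e f x + planeRotation θ e f y := by
  simp only [planeRotation, inner_add_right]
  module

theorem planeRotation_zero (e f x : E n) : planeRotation 0 e f x = x := by
  simp [planeRotation]

theorem planeRotation_two_pi (e f x : E n) : planeRotation (2 * Real.pi) e f x = x := by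
  simp [planeRotation]

theorem norm_planeRotation {e f : E n} (he : ‖e‖ = 1) (hf : ‖f‖ = 1) (hef : inner ℝ e f = 0)
    (θ : ℝ) (x : E n) : ‖planeRotation θ e f x‖ = ‖x‖ := by
  refine (sq_eq_sq₀ (norm_nonneg _) (norm_nonneg _)).1 ?_
  rw [← real_inner_self_eq_norm_sq, inner_planeRotation he hf hef, real_inner_self_eq_norm_sq]

theorem planeRotation_neg_planeRotation {e f : E n} (he : ‖e‖ = 1) (hf : ‖f‖ = 1)
    (hef : inner ℝ e f = 0) (θ : ℝ) (x : E n) :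
    planeRotation (-θ) (planeRotation θ e f e) (planeRotation θ e f f) (planeRotation θ e f x) =
      x := by
  have h1 : inner ℝ (planeRotation θ e f e) (planeRotation θ e f x) = inner ℝ e x :=
    inner_planeRotation he hf hef θ e x
  have h2 : inner ℝ (planeRotation θ e f f) (planeRotation θ e f x) = inner ℝ f x :=
    inner_planeRotation he hf hef θ f x
  rw [planeRotation, h1, h2, planeRotation_left he hef, planeRotation_right hf hef, planeRotation,
    Real.cos_neg, Real.sin_neg]
  have hcs := Real.cos_sq_add_sin_sq θ
  linear_combination (norm := module) (inner ℝ e x * hcs) • e + (inner ℝ f x * hcs) • f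

theorem rotation_eq_planeRotation {a b : E n} (hab : inner ℝ a b = 0) (θ : ℝ) (x : E n) :
    rotation θ a b x = planeRotation θ (unitVec a) (unitVec b) x := by
  rw [rotation, show inner ℝ (unitVec a) b = 0 by simp [unitVec, inner_smul_left, hab], zero_smul,
    sub_zero]

theorem norm_unitVec {a : E n} (ha : a ≠ 0) : ‖unitVec a‖ = 1 := by
  rw [unitVec, norm_smul, norm_inv, norm_norm, inv_mul_cancel₀ (norm_ne_zero_iff.2 ha)]

theorem inner_unitVec {a b : E n} (hab : inner ℝ a b = 0) : inner ℝ (unitVec a)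
    (unitVec b) = 0 := by
  simp [unitVec, inner_smul_left, inner_smul_right, hab]

theorem norm_smul_unitVec (a : E n) : ‖a‖ • unitVec a = a := by
  rcases eq_or_ne a 0 with rfl | ha
  · simp
  · rw [unitVec, smul_smul, mul_inv_cancel₀ (norm_ne_zero_iff.2 ha), one_smul]

theorem contDiffAt_unitVec {W : Type*} [NormedAddCommGroup W] [NormedSpace ℝ W] {a : W → E n}
    {x : W} (ha : ContDiffAt ℝ ∞ a x) (h0 : a x ≠ 0) :
    ContDiffAt ℝ ∞ (fun x => unitVec (a x)) x :=
  ((ha.norm ℝ h0).inv (norm_ne_zero_iff.2 h0)).smul ha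

theorem contDiffAt_planeRotation {W : Type*} [NormedAddCommGroup W] [NormedSpace ℝ W] {φ : W → ℝ}
    {e f c : W → E n} {x : W} (hφ : ContDiffAt ℝ ∞ φ x) (he : ContDiffAt ℝ ∞ e x)
    (hf : ContDiffAt ℝ ∞ f x) (hc : ContDiffAt ℝ ∞ c x) :
    ContDiffAt ℝ ∞ (fun x => planeRotation (φ x) (e x) (f x) (c x)) x := by
  have hcos : ContDiffAt ℝ ∞ (fun x => Real.cos (φ x)) x := Real.contDiff_cos.contDiffAt.comp x hφ
  have hsin : ContDiffAt ℝ ∞ (fun x => Real.sin (φ x)) x := Real.contDiff_sin.contDiffAt.comp x hφ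
  have hec := he.inner ℝ hc
  have hfc := hf.inner ℝ hc
  exact (hc.add ((hcos.sub contDiffAt_const).smul ((hec.smul he).add (hfc.smul hf)))).add
    (hsin.smul ((hec.smul hf).sub (hfc.smul he)))

end Rotation

/-! ### Cross products -/

theorem contDiff_bilinear {n : ℕ} (B : E n →ₗ[ℝ] E n →ₗ[ℝ] E n) :
    ContDiff ℝ ∞ (fun p : E n × E n => B p.1 p.2) := by
  let B' : E n →L[ℝ] E n →L[ℝ] E n :=
    LinearMap.toContinuousLinearMap (LinearMap.toContinuousLinearMap.toLinearMap ∘ₗ B)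
  exact B'.isBoundedBilinearMap.contDiff

namespace IsCrossProduct

variable {n : ℕ} {B : E n →ₗ[ℝ] E n →ₗ[ℝ] E n}

theorem self (hB : IsCrossProduct B) (a : E n) : B a a = 0 := by
  have h := (hB a a).2.2
  rw [real_inner_self_eq_norm_sq] at h
  have : ‖B a a‖ ^ 2 = 0 := by rw [h]; ring
  simpa using this

theorem anticomm (hB : IsCrossProduct B) (a b : E n) : B b a = -B a b := by
  have h := hB.self (a + b)
  simp only [map_add, LinearMap.add_apply, hB.self] at h
  rw [zero_add, add_zero] at h
  exact eq_neg_of_add_eq_zero_left h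

theorem inner_left (hB : IsCrossProduct B) (a b : E n) : inner ℝ a (B a b) = 0 := by
  rw [real_inner_comm, (hB a b).1]

theorem inner_right (hB : IsCrossProduct B) (a b : E n) : inner ℝ b (B a b) = 0 := by
  rw [real_inner_comm, (hB a b).2.1]

theorem inner_swap (hB : IsCrossProduct B) (a b c : E n) :
    inner ℝ (B a b) c = -inner ℝ (B a c) b := by
  have h := (hB a (b + c)).2.1
  simp only [map_add, inner_add_left, inner_add_right, (hB a b).2.1, (hB a c).2.1] at h
  linarith

theorem inner_apply_apply (hB : IsCrossProduct B) (a b c : E n) :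
    inner ℝ (B a b) (B a c) = ‖a‖ ^ 2 * inner ℝ b c - inner ℝ a b * inner ℝ a c := by
  have h := (hB a (b + c)).2.2
  have hb := (hB a b).2.2
  have hc := (hB a c).2.2
  rw [map_add, norm_add_sq_real, norm_add_sq_real, inner_add_right] at h
  linear_combination (h - hb - hc) / 2

/-- Polarising the axioms makes `a × ·` skew and computes `⟨a × b, a × c⟩`; together they determine
the pairing of `a × (a × b)` with every `c`. -/
theorem apply_apply (hB : IsCrossProduct B) (a b : E n) :
    B a (B a b) = inner ℝ a b • a - ‖a‖ ^ 2 • b := by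
  refine ext_inner_right ℝ fun c => ?_
  rw [hB.inner_swap, hB.inner_apply_apply, inner_sub_left, inner_smul_left, inner_smul_left,
    real_inner_comm b c]
  simp
  ring

theorem apply_apply_of_inner_eq_zero (hB : IsCrossProduct B) {u v : E n} (hu : ‖u‖ = 1)
    (huv : inner ℝ u v = 0) :
    B u (B u v) = -v := by
  rw [hB.apply_apply, huv, hu]
  simp

theorem norm_apply (hB : IsCrossProduct B) {u v : E n} (hu : ‖u‖ = 1) (huv : inner ℝ u v = 0) :
    ‖B u v‖ = ‖v‖ := by
  refine (sq_eq_sq₀ (norm_nonneg _) (norm_nonneg _)).1 ?_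
  rw [(hB u v).2.2, hu, huv]
  ring

/-- A rotation in a plane spanned by `f` and a combination of `u` and `u × f` is compatible
with the cross product of `u` and `f`. -/
theorem apply_planeRotation (hB : IsCrossProduct B) {u f : E n} (hu : ‖u‖ = 1) (hf : ‖f‖ = 1)
    (huf : inner ℝ u f = 0)
    {α β : ℝ} (hαβ : α ^ 2 + β ^ 2 = 1) (θ : ℝ) :
    B (planeRotation θ (α • u + β • B u f) f u) (planeRotation θ (α • u + β • B u f) f f) =
      planeRotation θ (α • u + β • B u f) f (B u f) := by
  -- The triple `u`, `f`, `u × f` is orthonormal and multiplies like the standard basis of `ℝ³`. The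
  -- rotation preserves its span and orientation, hence the product; the table below reduces this to
  -- scalar identities.
  have huw : B u (B u f) = -f := hB.apply_apply_of_inner_eq_zero hu huf
  have hfw : B f (B u f) = u := by
    rw [← neg_neg (B u f), ← hB.anticomm u f, map_neg, hB.apply_apply, hf, real_inner_comm, huf]
    simp
  have hfu : B f u = -B u f := hB.anticomm u f
  have hwu : B (B u f) u = f := by rw [hB.anticomm u, huw, neg_neg]
  have hwf : B (B u f) f = -u := by rw [hB.anticomm f, hfw]
  have hww := hB.self (B u f)
  have huu := hB.self u
  have hff := hB.self f
  have hnw : ‖B u f‖ = 1 := by rw [hB.norm_apply hu huf, hf]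
  have i1 := (hB u f).1
  have i2 := (hB u f).2.1
  have i3 := hB.inner_left u f
  have i4 := hB.inner_right u f
  have hfu' : inner ℝ f u = 0 := by rw [real_inner_comm, huf]
  generalize huf' : B u f = w at *
  have hcs := Real.cos_sq_add_sin_sq θ
  simp only [planeRotation, inner_add_left, inner_smul_left, real_inner_self_eq_norm_sq, hu, hf,
    hnw, huf, hfu', i1, i2, i3, i4, map_add, map_sub, map_smul, LinearMap.add_apply,
    LinearMap.sub_apply, LinearMap.smul_apply, huf', huw, hfw, hfu, hwu, hwf, hww, huu, hff]
  simp
  linear_combination (norm := module) (-(α * β) * hcs) • u + (α ^ 2 * hcs - (Real.cos θ - 1) * hαβ) • w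

end IsCrossProduct

/-! ### The isotopies defined by a cross product -/

section CrossTwist

variable {n : ℕ} {B : E n →ₗ[ℝ] E n →ₗ[ℝ] E n} {θ : ℝ → ℝ} {t : ℝ} {p : E n × E n}

/-- The first vector `(1 - t) u + t u × v` that spans the plane of the rotation `crossTwist`. -/
noncomputable def crossAxis (B : E n →ₗ[ℝ] E n →ₗ[ℝ] E n) (t : ℝ) (p : E n × E n) : E n :=
  (1 - t) • p.1 + t • B p.1 p.2

theorem inner_crossAxis (hB : IsCrossProduct B) (t : ℝ) (hp : ‖p.1‖ = 1 ∧ inner ℝ p.1 p.2 = 0) :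
    inner ℝ (crossAxis B t p) p.2 = 0 := by
  rw [crossAxis, inner_add_left, inner_smul_left, inner_smul_left, hp.2, (hB p.1 p.2).2.1]
  simp

theorem norm_crossAxis_sq (hB : IsCrossProduct B) (t : ℝ)
    (hp : ‖p.1‖ = 1 ∧ inner ℝ p.1 p.2 = 0) :
    ‖crossAxis B t p‖ ^ 2 = (1 - t) ^ 2 + t ^ 2 * ‖p.2‖ ^ 2 := by
  rw [crossAxis, norm_comb_sq (hB.inner_left p.1 p.2), hp.1, hB.norm_apply hp.1 hp.2]
  ring

theorem crossAxis_ne_zero (hB : IsCrossProduct B) (t : ℝ)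
    (hp : ‖p.1‖ = 1 ∧ inner ℝ p.1 p.2 = 0) (hv : p.2 ≠ 0) : crossAxis B t p ≠ 0 := by
  intro h
  have h1 := norm_crossAxis_sq hB t hp
  rw [h, norm_zero] at h1
  have hm : 0 < ‖p.2‖ := norm_pos_iff.2 hv
  have h2 : t * ‖p.2‖ = 0 := by nlinarith [sq_nonneg (1 - t), sq_nonneg (t * ‖p.2‖)]
  have h3 : t = 0 := (mul_eq_zero.1 h2).resolve_right hm.ne'
  rw [h3] at h1
  norm_num at h1

theorem crossTwist_of_ne_zero (hB : IsCrossProduct B) (θ : ℝ → ℝ) (t : ℝ)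
    (hp : ‖p.1‖ = 1 ∧ inner ℝ p.1 p.2 = 0) (hv : p.2 ≠ 0) :
    crossTwist B θ t p =
      (planeRotation (θ ‖p.2‖) (unitVec (crossAxis B t p)) (unitVec p.2) p.1,
        planeRotation (θ ‖p.2‖) (unitVec (crossAxis B t p)) (unitVec p.2) p.2) := by
  rw [crossTwist, if_neg hv]
  exact Prod.ext (rotation_eq_planeRotation (inner_crossAxis hB t hp) _ _)
    (rotation_eq_planeRotation (inner_crossAxis hB t hp) _ _)

theorem crossTwist_of_eq_zero (B : E n →ₗ[ℝ] E n →ₗ[ℝ] E n) (θ : ℝ → ℝ) (t : ℝ) (hv : p.2 = 0) :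
    crossTwist B θ t p = p :=
  if_pos hv

theorem crossTwist_eq_self_of_angle_eq_zero (hB : IsCrossProduct B) (t : ℝ)
    (hp : ‖p.1‖ = 1 ∧ inner ℝ p.1 p.2 = 0) (hθ : θ ‖p.2‖ = 0) : crossTwist B θ t p = p := by
  by_cases hv : p.2 = 0
  · exact crossTwist_of_eq_zero B θ t hv
  · rw [crossTwist_of_ne_zero hB θ t hp hv, hθ, planeRotation_zero, planeRotation_zero]

theorem crossTwist_eq_self_of_angle_eq_two_pi (hB : IsCrossProduct B) (t : ℝ)
    (hp : ‖p.1‖ = 1 ∧ inner ℝ p.1 p.2 = 0) (hθ : θ ‖p.2‖ = 2 * Real.pi) :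
    crossTwist B θ t p = p := by
  by_cases hv : p.2 = 0
  · exact crossTwist_of_eq_zero B θ t hv
  · rw [crossTwist_of_ne_zero hB θ t hp hv, hθ, planeRotation_two_pi, planeRotation_two_pi]

theorem crossTwist_mem (hB : IsCrossProduct B) (θ : ℝ → ℝ) (t : ℝ)
    (hp : ‖p.1‖ = 1 ∧ inner ℝ p.1 p.2 = 0) :
    ‖(crossTwist B θ t p).1‖ = 1 ∧ inner ℝ (crossTwist B θ t p).1 (crossTwist B θ t p).2 = 0 := by
  by_cases hv : p.2 = 0
  · rwa [crossTwist_of_eq_zero B θ t hv]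
  · have he := norm_unitVec (crossAxis_ne_zero hB t hp hv)
    have hf := norm_unitVec hv
    have hef := inner_unitVec (inner_crossAxis hB t hp)
    rw [crossTwist_of_ne_zero hB θ t hp hv]
    exact ⟨(norm_planeRotation he hf hef _ _).trans hp.1,
      (inner_planeRotation he hf hef _ _ _).trans hp.2⟩

/-- `crossTwist` with the opposite angle is an inverse. -/
theorem crossTwist_neg_crossTwist (hB : IsCrossProduct B) (θ : ℝ → ℝ) (t : ℝ)
    (hp : ‖p.1‖ = 1 ∧ inner ℝ p.1 p.2 = 0) :
    crossTwist B (fun r => -θ r) t (crossTwist B θ t p) = p := by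
  by_cases hv : p.2 = 0
  · rw [crossTwist_of_eq_zero B θ t hv, crossTwist_of_eq_zero B _ t hv]
  have ha := crossAxis_ne_zero hB t hp hv
  have he := norm_unitVec ha
  have hf := norm_unitVec hv
  have hef := inner_unitVec (inner_crossAxis hB t hp)
  have hmem := crossTwist_mem hB θ t hp
  have huf : inner ℝ p.1 (unitVec p.2) = 0 := by simp [unitVec, inner_smul_right, hp.2]
  have hN : ‖crossAxis B t p‖ ≠ 0 := norm_ne_zero_iff.2 ha
  have hBv : B p.1 p.2 = ‖p.2‖ • B p.1 (unitVec p.2) := by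
    conv_lhs => rw [← norm_smul_unitVec p.2, map_smul]
  have hunit : unitVec (crossAxis B t p) = ((1 - t) / ‖crossAxis B t p‖) • p.1 +
      (t * ‖p.2‖ / ‖crossAxis B t p‖) • B p.1 (unitVec p.2) := by
    have haxis : crossAxis B t p = (1 - t) • p.1 + (t * ‖p.2‖) • B p.1 (unitVec p.2) := by
      rw [crossAxis, hBv, smul_smul]
    rw [unitVec]
    nth_rewrite 2 [haxis]
    match_scalars <;> field_simp
  have hαβ : ((1 - t) / ‖crossAxis B t p‖) ^ 2 + (t * ‖p.2‖ / ‖crossAxis B t p‖) ^ 2 = 1 := by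
    field_simp
    rw [norm_crossAxis_sq hB t hp]
  have hrot := hB.apply_planeRotation hp.1 hf huf hαβ (θ ‖p.2‖)
  rw [← hunit] at hrot
  rw [crossTwist_of_ne_zero hB θ t hp hv] at hmem ⊢
  set Q : E n → E n :=
    planeRotation (θ ‖p.2‖) (unitVec (crossAxis B t p)) (unitVec p.2) with hQ
  have hQnorm : ∀ x, ‖Q x‖ = ‖x‖ := norm_planeRotation he hf hef _
  have hQsmul : ∀ (c : ℝ) x, Q (c • x) = c • Q x := planeRotation_smul _ _ _
  have hQB : B (Q p.1) (Q p.2) = Q (B p.1 p.2) := by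
    have h1 : Q p.2 = ‖p.2‖ • Q (unitVec p.2) := by rw [← hQsmul, norm_smul_unitVec]
    rw [h1, map_smul, hrot, hBv, hQsmul]
  -- The axis at the image point is the image of the axis. The second rotation thus takes place in
  -- the same plane with the same orientation, and the opposite angle undoes the first.
  have hQaxis : crossAxis B t (Q p.1, Q p.2) = Q (crossAxis B t p) := by
    rw [crossAxis, crossAxis, hQB, hQ, planeRotation_add, planeRotation_smul, planeRotation_smul]
  have hQunit : ∀ x, unitVec (Q x) = Q (unitVec x) := fun x => by
    rw [unitVec, unitVec, hQnorm, hQsmul]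
  have hQv : Q p.2 ≠ 0 := by
    rw [← norm_ne_zero_iff, hQnorm]
    exact norm_ne_zero_iff.2 hv
  rw [crossTwist_of_ne_zero hB _ t hmem hQv]
  simp only [hQaxis, hQunit, hQnorm]
  exact Prod.ext (planeRotation_neg_planeRotation he hf hef _ _)
    (planeRotation_neg_planeRotation he hf hef _ _)

/-- The map `crossTwist` on `T*Sⁿ`. -/
noncomputable def crossPoint (hB : IsCrossProduct B) (θ : ℝ → ℝ) (t : ℝ) (x : CotangentSphere n) :
    CotangentSphere n :=
  ⟨crossTwist B θ t x.1, crossTwist_mem hB θ t x.2⟩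

theorem isSmooth_crossPoint (hB : IsCrossProduct B) (hθ : ContDiff ℝ ∞ θ) (h0 : ∀ r < 1, θ r = 0) :
    IsSmooth (inclI n) (incl n)
      (fun q : unitInterval × CotangentSphere n => crossPoint hB θ q.1 q.2) := by
  rintro ⟨t, x⟩
  rcases lt_or_ge ‖x.1.2‖ 1 with hx | hx
  -- Here the angle is zero and the map is the identity; elsewhere the axis and `v` are both
  -- nonzero, so normalising them is smooth.
  · refine ⟨{q | ‖q.2.2‖ < 1}, isOpen_lt (by fun_prop) continuous_const, hx, Prod.snd,
      contDiff_snd.contDiffOn, fun q hq => ?_⟩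
    exact (crossTwist_eq_self_of_angle_eq_zero hB _ q.2.2 (h0 _ hq)).symm
  · have haxis : ContDiff ℝ ∞ (fun q : ℝ × (E n × E n) => crossAxis B q.1 q.2) :=
      ((contDiff_const.sub contDiff_fst).smul contDiff_snd.fst).add
        (contDiff_fst.smul ((contDiff_bilinear B).comp contDiff_snd))
    have hxv : x.1.2 ≠ 0 := by
      rw [← norm_ne_zero_iff]
      linarith
    refine ⟨{q | q.2.2 ≠ 0} ∩ {q | crossAxis B q.1 q.2 ≠ 0},
      (isOpen_ne_fun (by fun_prop) continuous_const).inter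
        (isOpen_ne_fun haxis.continuous continuous_const),
      ⟨hxv, crossAxis_ne_zero hB t x.2 hxv⟩, fun q =>
      (planeRotation (θ ‖q.2.2‖) (unitVec (crossAxis B q.1 q.2)) (unitVec q.2.2) q.2.1,
        planeRotation (θ ‖q.2.2‖) (unitVec (crossAxis B q.1 q.2)) (unitVec q.2.2) q.2.2),
      fun q hq => ContDiffAt.contDiffWithinAt ?_, fun q hq => ?_⟩
    · have hu : ContDiffAt ℝ ∞ (fun q : ℝ × (E n × E n) => q.2.1) q := contDiff_snd.fst.contDiffAt
      have hv : ContDiffAt ℝ ∞ (fun q : ℝ × (E n × E n) => q.2.2) q := contDiff_snd.snd.contDiffAt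
      have hφ : ContDiffAt ℝ ∞ (fun q : ℝ × (E n × E n) => θ ‖q.2.2‖) q :=
        hθ.contDiffAt.comp q (hv.norm ℝ hq.1)
      have he := contDiffAt_unitVec haxis.contDiffAt hq.2
      have hf := contDiffAt_unitVec hv hq.1
      exact (contDiffAt_planeRotation hφ he hf hu).prodMk (contDiffAt_planeRotation hφ he hf hv)
    · exact (crossTwist_of_ne_zero hB θ _ q.2.2 hq.1).symm

theorem exists_isIsotopy_crossTwist (hB : IsCrossProduct B) {R : ℝ} (hθ : ContDiff ℝ ∞ θ)
    (h0 : ∀ r < 1, θ r = 0) (hR : ∀ r > R, θ r = 2 * Real.pi) :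
    ∃ S : unitInterval → DiffC n, IsIsotopy S ∧ ∀ (t : unitInterval) (x : CotangentSphere n),
      ((S t : Equiv.Perm (CotangentSphere n)) x).1 = crossTwist B θ t x.1 := by
  obtain ⟨S, hS, hSf⟩ := exists_isIsotopy (fun t x => crossPoint hB θ t x)
    (fun t x => crossPoint hB (fun r => -θ r) t x)
    (fun t x => Subtype.ext (crossTwist_neg_crossTwist hB θ t x.2))
    (fun t x => Subtype.ext (by
      have h := crossTwist_neg_crossTwist hB (fun r => -θ r) t x.2
      simp only [neg_neg] at h
      exact h))
    (isSmooth_crossPoint hB hθ h0)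
    (isSmooth_crossPoint hB hθ.neg fun r hr => by rw [h0 r hr, neg_zero])
    R (fun t x hx => Subtype.ext (crossTwist_eq_self_of_angle_eq_two_pi hB t x.2 (hR _ hx)))
  exact ⟨S, hS, fun t x => by rw [hSf]; rfl⟩

/-- The rotation of `v` by the angle `φ` in the tangent plane spanned by `u × v` and `v`. -/
noncomputable def fiberRotation (B : E n →ₗ[ℝ] E n →ₗ[ℝ] E n) (φ : ℝ) (p : E n × E n) : E n × E n :=
  (p.1, Real.cos φ • p.2 - Real.sin φ • B p.1 p.2)

theorem crossTwist_one (hB : IsCrossProduct B) (θ : ℝ → ℝ)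
    (hp : ‖p.1‖ = 1 ∧ inner ℝ p.1 p.2 = 0) :
    crossTwist B θ 1 p = fiberRotation B (θ ‖p.2‖) p := by
  by_cases hv : p.2 = 0
  · rw [crossTwist_of_eq_zero B θ 1 hv]
    exact Prod.ext rfl (by simp [fiberRotation, hv])
  · have hm : ‖p.2‖ ≠ 0 := norm_ne_zero_iff.2 hv
    have haxis : crossAxis B 1 p = B p.1 p.2 := by simp [crossAxis]
    rw [crossTwist_of_ne_zero hB θ 1 hp hv, haxis]
    have h1 : inner ℝ (B p.1 p.2) p.1 = 0 := (hB p.1 p.2).1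
    have h2 : inner ℝ (B p.1 p.2) p.2 = 0 := (hB p.1 p.2).2.1
    have h3 : inner ℝ p.2 p.1 = 0 := by rw [real_inner_comm, hp.2]
    ext1
    · simp [planeRotation, fiberRotation, unitVec, inner_smul_left, h1, h3]
    · simp only [planeRotation, fiberRotation, unitVec, inner_smul_left, h2,
        real_inner_self_eq_norm_sq, hB.norm_apply hp.1 hp.2]
      simp
      match_scalars <;> field_simp
      ring

theorem norm_fiberRotation_snd (hB : IsCrossProduct B) (φ : ℝ)
    (hp : ‖p.1‖ = 1 ∧ inner ℝ p.1 p.2 = 0) : ‖(fiberRotation B φ p).2‖ = ‖p.2‖ := by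
  refine (sq_eq_sq₀ (norm_nonneg _) (norm_nonneg _)).1 ?_
  have h := norm_comb_sq (hB.inner_right p.1 p.2) (Real.cos φ) (-Real.sin φ)
  rw [neg_smul, ← sub_eq_add_neg] at h
  rw [fiberRotation, h, hB.norm_apply hp.1 hp.2]
  linear_combination ‖p.2‖ ^ 2 * Real.cos_sq_add_sin_sq φ

theorem fiberRotation_mem (hB : IsCrossProduct B) (φ : ℝ)
    (hp : ‖p.1‖ = 1 ∧ inner ℝ p.1 p.2 = 0) :
    ‖(fiberRotation B φ p).1‖ = 1 ∧ inner ℝ (fiberRotation B φ p).1 (fiberRotation B φ p).2 = 0 := by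
  refine ⟨hp.1, ?_⟩
  rw [fiberRotation, inner_sub_right, inner_smul_right, inner_smul_right, hp.2, hB.inner_left]
  simp

/-- On the orthogonal complement of `u`, the map `u × ·` squares to `-1`, so this is multiplication
by `e^{-iφ}` in the fibre. -/
theorem fiberRotation_neg_fiberRotation (hB : IsCrossProduct B) (φ : ℝ)
    (hp : ‖p.1‖ = 1 ∧ inner ℝ p.1 p.2 = 0) :
    fiberRotation B (-φ) (fiberRotation B φ p) = p := by
  refine Prod.ext rfl ?_
  simp only [fiberRotation, map_sub, map_smul, hB.apply_apply_of_inner_eq_zero hp.1 hp.2,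
    Real.cos_neg, Real.sin_neg]
  linear_combination (norm := module) Real.cos_sq_add_sin_sq φ • p.2

/-- `fiberRotation` needs no normalisation of `v`, so it is smooth at the zero section even where
the angle `(1-s)θ + 2πs` is nonzero. For large `|v|` the angle is `2π` for every `s`, which keeps
the support compact. -/
theorem exists_isIsotopy_crossTwist_one (hB : IsCrossProduct B) {R : ℝ} (hθ : ContDiff ℝ ∞ θ)
    (h0 : ∀ r < 1, θ r = 0) (hR : ∀ r > R, θ r = 2 * Real.pi) :
    ∃ S : unitInterval → DiffC n, IsIsotopy S ∧ ∀ (s : unitInterval) (x : CotangentSphere n),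
      ((S s : Equiv.Perm (CotangentSphere n)) x).1 =
        crossTwist B (fun r => (1 - (s : ℝ)) * θ r + s * (2 * Real.pi)) 1 x.1 := by
  let φ : ℝ → E n → ℝ := fun s v => (1 - s) * θ ‖v‖ + s * (2 * Real.pi)
  have hθn : ContDiff ℝ ∞ (fun q : ℝ × (E n × E n) => θ ‖q.2.2‖) := by
    refine ContDiff.comp (g := fun v : E n => θ ‖v‖) (contDiff_comp_norm hθ ⟨1, one_pos, ?_⟩)
      contDiff_snd.snd
    intro t ht
    rw [h0 t (abs_lt.1 ht).2, h0 (-t) (by linarith [(abs_lt.1 ht).1])]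
  have hφ : ContDiff ℝ ∞ (fun q : ℝ × (E n × E n) => φ q.1 q.2.2) :=
    ((contDiff_const.sub contDiff_fst).mul hθn).add (contDiff_fst.mul contDiff_const)
  let Z : ℝ → unitInterval → CotangentSphere n → CotangentSphere n := fun ε s x =>
    ⟨fiberRotation B (ε * φ s x.1.2) x.1, fiberRotation_mem hB _ x.2⟩
  have hφZ : ∀ (ε s) (s' : unitInterval) (x : CotangentSphere n),
      φ s (Z ε s' x).1.2 = φ s x.1.2 := fun ε s s' x => by
    simp only [φ]
    rw [norm_fiberRotation_snd hB _ x.2]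
  have hsmooth : ∀ ε, IsSmooth (inclI n) (incl n)
      (fun q : unitInterval × CotangentSphere n => Z ε q.1 q.2) := fun ε => by
    have hε : ContDiff ℝ ∞ (fun q : ℝ × (E n × E n) => ε * φ q.1 q.2.2) := contDiff_const.mul hφ
    have hcos := Real.contDiff_cos.comp hε
    have hsin := Real.contDiff_sin.comp hε
    exact IsSmooth.of_contDiff (F := fun q => fiberRotation B (ε * φ q.1 q.2.2) q.2)
      (contDiff_snd.fst.prodMk ((hcos.smul contDiff_snd.snd).sub
        (hsin.smul ((contDiff_bilinear B).comp contDiff_snd)))) fun _ => rfl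
  have hinv : ∀ ε s x, Z (-ε) s (Z ε s x) = x := fun ε s x => Subtype.ext (by
    change fiberRotation B (-ε * φ s (Z ε s x).1.2) (fiberRotation B (ε * φ s x.1.2) x.1) = x.1
    rw [hφZ, neg_mul, fiberRotation_neg_fiberRotation hB _ x.2])
  obtain ⟨S, hS, hSf⟩ := exists_isIsotopy (Z 1) (Z (-1)) (hinv 1)
    (fun s x => by simpa using hinv (-1) s x) (hsmooth 1) (hsmooth (-1)) R
    (fun s x hx => Subtype.ext (by
      have : φ s x.1.2 = 2 * Real.pi := by simp only [φ]; rw [hR _ hx]; ring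
      simp only [Z, this]
      exact Prod.ext rfl (by simp [fiberRotation])))
  refine ⟨S, hS, fun s x => ?_⟩
  rw [hSf, crossTwist_one hB _ x.2]
  simp only [Z, φ, one_mul]

/-- For `t = 0`, the map `crossTwist` is a rotation in the planes `(u, v)`. -/
theorem crossTwist_zero (hB : IsCrossProduct B) (θ : ℝ → ℝ)
    (hp : ‖p.1‖ = 1 ∧ inner ℝ p.1 p.2 = 0) :
    crossTwist B θ 0 p = geodesicMap (θ ‖p.2‖ / ‖p.2‖) p := by
  by_cases hv : p.2 = 0
  · rw [crossTwist_of_eq_zero B θ 0 hv, geodesicMap_of_snd_eq_zero _ hv]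
  · have hm : ‖p.2‖ ≠ 0 := norm_ne_zero_iff.2 hv
    have haxis : crossAxis B 0 p = p.1 := by simp [crossAxis]
    have h3 : inner ℝ p.2 p.1 = 0 := by rw [real_inner_comm, hp.2]
    rw [crossTwist_of_ne_zero hB θ 0 hp hv, geodesicMap_div _ hv, haxis]
    ext1
    · simp only [planeRotation, unitVec, inner_smul_left, h3, real_inner_self_eq_norm_sq, hp.1]
      simp
      match_scalars <;> field_simp
      ring
    · simp only [planeRotation, unitVec, inner_smul_left, hp.2, real_inner_self_eq_norm_sq, hp.1]
      simp
      match_scalars <;> field_simp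
      ring

theorem contDiff_div_norm (hθ : ContDiff ℝ ∞ θ) (h0 : ∀ r < 1, θ r = 0) :
    ContDiff ℝ ∞ (fun v : E n => θ ‖v‖ / ‖v‖) := by
  refine contDiff_iff_contDiffAt.2 fun v => ?_
  rcases eq_or_ne v 0 with rfl | hv
  · refine (contDiffAt_const (c := (0 : ℝ))).congr_of_eventuallyEq ?_
    filter_upwards [Metric.ball_mem_nhds (0 : E n) one_pos] with w hw
    rw [h0 _ (by simpa using hw), zero_div]
  · exact (hθ.contDiffAt.comp v (contDiffAt_norm ℝ hv)).div (contDiffAt_norm ℝ hv)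
      (norm_ne_zero_iff.2 hv)

end CrossTwist

/-! ### Existence of cross products -/

/-- The vector product of `ℝ³`. -/
noncomputable def crossProductThree : E 2 →ₗ[ℝ] E 2 →ₗ[ℝ] E 2 :=
  LinearMap.mk₂ ℝ (fun a b => WithLp.toLp 2 fun i => a (i + 1) * b (i + 2) - a (i + 2) * b (i + 1))
    (fun a a' b => by ext i; simp; ring) (fun c a b => by ext i; simp; ring)
    (fun a b b' => by ext i; simp; ring) (fun c a b => by ext i; simp; ring)

/-- The cross product of `ℝ⁷`, the imaginary part of the multiplication of octonions. -/
noncomputable def crossProductSeven : E 6 →ₗ[ℝ] E 6 →ₗ[ℝ] E 6 :=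
  LinearMap.mk₂ ℝ (fun a b => WithLp.toLp 2 fun i =>
      a (i + 1) * b (i + 3) - a (i + 3) * b (i + 1) + (a (i + 2) * b (i + 6) - a (i + 6) * b (i + 2))
        + (a (i + 4) * b (i + 5) - a (i + 5) * b (i + 4)))
    (fun a a' b => by ext i; simp; ring) (fun c a b => by ext i; simp; ring)
    (fun a b b' => by ext i; simp; ring) (fun c a b => by ext i; simp; ring)

theorem isCrossProduct_crossProductThree : IsCrossProduct crossProductThree := by
  intro a b
  simp only [EuclideanSpace.real_norm_sq_eq, PiLp.inner_apply, crossProductThree,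
    LinearMap.mk₂_apply, Fin.sum_univ_succ, Fin.isValue]
  simp [Fin.reduceAdd]
  refine ⟨?_, ?_, ?_⟩ <;> ring

/-- With indices modulo `7`, the product is given by `e_j × e_{j+1} = e_{j+3}` and its cyclic
permutations, one triple for each line of the Fano plane. The axioms are polynomial identities in
the coordinates. -/
theorem isCrossProduct_crossProductSeven : IsCrossProduct crossProductSeven := by
  intro a b
  simp only [EuclideanSpace.real_norm_sq_eq, PiLp.inner_apply, crossProductSeven,
    LinearMap.mk₂_apply, Fin.sum_univ_succ, Fin.isValue]
  simp [Fin.reduceAdd]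
  refine ⟨?_, ?_, ?_⟩ <;> ring

theorem exists_isCrossProduct {n : ℕ} (hn : n = 2 ∨ n = 6) :
    ∃ B : E n →ₗ[ℝ] E n →ₗ[ℝ] E n, IsCrossProduct B := by
  rcases hn with rfl | rfl
  · exact ⟨_, isCrossProduct_crossProductThree⟩
  · exact ⟨_, isCrossProduct_crossProductSeven⟩

/-! ### The square of the Dehn twist -/

section Square

variable {n : ℕ} {ρ : ℝ → ℝ}

/-- If the square of a Dehn twist is composed with `crossTwist B θ 0`, the result is isotopic to
the identity. -/
theorem isotopyClass_mul_sq_eq_one {B : E n →ₗ[ℝ] E n →ₗ[ℝ] E n} (hB : IsCrossProduct B)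
    (hρ : IsTwistProfile ρ) {τ S : DiffC n}
    (hτ : ∀ x, ((τ : Equiv.Perm (CotangentSphere n)) x).1 =
      -geodesicMap (twistRate ρ ‖x.1.2‖) x.1)
    {R : ℝ} {θ : ℝ → ℝ} (hθ : ContDiff ℝ ∞ θ) (h0 : ∀ r < 1, θ r = 0)
    (hR : ∀ r > R, θ r = 2 * Real.pi)
    (hS : ∀ x, ((S : Equiv.Perm (CotangentSphere n)) x).1 = crossTwist B θ 0 x.1) :
    isotopyClass (S * τ ^ 2) = 1 := by
  have hS' : ∀ x, ((S : Equiv.Perm (CotangentSphere n)) x).1 =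
      geodesicMap (θ ‖x.1.2‖ / ‖x.1.2‖) x.1 := fun x => (hS x).trans (crossTwist_zero hB θ x.2)
  obtain ⟨T, hT0, hT⟩ := hρ.exists_twistRate_eq
  have hnorm : ∀ x, ‖((τ : Equiv.Perm (CotangentSphere n)) x).1.2‖ = ‖x.1.2‖ := fun x => by
    rw [hτ, Prod.snd_neg, norm_neg, norm_geodesicMap_snd _ x.2]
  have hττ : ∀ x, ((τ : Equiv.Perm (CotangentSphere n))
      ((τ : Equiv.Perm (CotangentSphere n)) x)).1 =
        geodesicMap (twistRate ρ ‖x.1.2‖ + twistRate ρ ‖x.1.2‖) x.1 := fun x => by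
    rw [hτ, hnorm, hτ, geodesicMap_neg, neg_neg, geodesicMap_geodesicMap _ _ x.2]
  -- The rates add. For large `r` they are `2π/r` from `S` and `-π/r` from each `τ`, with sum zero.
  refine isotopyClass_eq_one_iff.2 (mem_isotopicToId_of_eq_geodesicMap (R := max R T)
    (k := fun r => θ r / r + (twistRate ρ r + twistRate ρ r))
    ((contDiff_div_norm hθ h0).add (hρ.contDiff_twistRate.add hρ.contDiff_twistRate))
    (fun r hr => ?_) _ fun x => ?_)
  · rw [hR r ((le_max_left _ _).trans_lt hr), hT r ((le_max_right _ _).trans_lt hr)]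
    ring
  · rw [sq, Subgroup.coe_mul, Subgroup.coe_mul, Equiv.Perm.mul_apply, Equiv.Perm.mul_apply, hS',
      hnorm, hnorm, hττ, geodesicMap_geodesicMap _ _ x.2]

/-- The two isotopies join `S 0` to the identity through `S 1 = S' 0`. With `[S 0][τ²] = 1` this
makes `[τ²]` trivial, so both classes agree because both are trivial. -/
theorem exists_crossTwist_isotopies {B : E n →ₗ[ℝ] E n →ₗ[ℝ] E n} (hB : IsCrossProduct B)
    (hρ : IsTwistProfile ρ) {τ : DiffC n}
    (hτ : ∀ x, ((τ : Equiv.Perm (CotangentSphere n)) x).1 =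
      -geodesicMap (twistRate ρ ‖x.1.2‖) x.1)
    {R : ℝ} {θ : ℝ → ℝ} (hθ : ContDiff ℝ ∞ θ) (h0 : ∀ r < 1, θ r = 0)
    (hR : ∀ r > R, θ r = 2 * Real.pi) :
    isotopyClass (τ ^ 2) = 1 ∧
    ∃ S S' : unitInterval → DiffC n, IsIsotopy S ∧ IsIsotopy S' ∧
      (∀ (t : unitInterval) (x : CotangentSphere n),
        ((S t : Equiv.Perm (CotangentSphere n)) x).1 = crossTwist B θ t x.1) ∧
      (∀ (s : unitInterval) (x : CotangentSphere n),
        ((S' s : Equiv.Perm (CotangentSphere n)) x).1 =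
          crossTwist B (fun r => (1 - (s : ℝ)) * θ r + s * (2 * Real.pi)) 1 x.1) ∧
      isotopyClass (S 0) = isotopyClass (τ ^ 2) ∧ S 1 = S' 0 ∧ S' 1 = 1 := by
  obtain ⟨S, hS, hSf⟩ := exists_isIsotopy_crossTwist hB hθ h0 hR
  obtain ⟨S', hS', hSf'⟩ := exists_isIsotopy_crossTwist_one hB hθ h0 hR
  have h1 : S 1 = S' 0 := DiffC.ext fun x => by
    rw [hSf, hSf']
    simp
  have h2 : S' 1 = 1 := DiffC.ext fun x => by
    rw [hSf', crossTwist_eq_self_of_angle_eq_two_pi hB _ x.2 (by simp)]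
    rfl
  have h3 : isotopyClass (S 0) = 1 := by
    rw [isotopyClass_eq_of_isIsotopy hS, h1, isotopyClass_eq_of_isIsotopy hS', h2]
    rfl
  have h4 : isotopyClass (τ ^ 2) = 1 := by
    have h5 : isotopyClass (S 0 * τ ^ 2) = isotopyClass (S 0) * isotopyClass (τ ^ 2) := rfl
    rw [isotopyClass_mul_sq_eq_one hB hρ hτ hθ h0 hR fun x => hSf 0 x, h3, one_mul] at h5
    exact h5.symm
  exact ⟨h4, S, S', hS, hS', hSf, hSf', h3.trans h4.symm, h1, h2⟩

end Square

end DehnTwist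

theorem mainTheorem3 (n : ℕ) (hn : n = 2 ∨ n = 6) (ρ : ℝ → ℝ) (hρ : IsTwistProfile ρ) :
    (∃! τ : DiffC n, IsDehnTwist ρ τ) ∧
    ∀ τ : DiffC n, IsDehnTwist ρ τ →
      -- `[τ]` has order `2` in `π₀ Diff_c(T*Sⁿ)`
      orderOf (isotopyClass τ) = 2 ∧
      -- there is an explicit isotopy, built from a cross product on `ℝⁿ⁺¹`
      (∃ B : E n →ₗ[ℝ] E n →ₗ[ℝ] E n, IsCrossProduct B) ∧
      ∀ B : E n →ₗ[ℝ] E n →ₗ[ℝ] E n, IsCrossProduct B →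
      ∀ (R : ℝ) (θ : ℝ → ℝ), 1 < R → ContDiff ℝ ∞ θ →
        (∀ r < 1, θ r = 0) → (∀ r > R, θ r = 2 * Real.pi) →
        ∃ S S' : unitInterval → DiffC n, IsIsotopy S ∧ IsIsotopy S' ∧
          (∀ (t : unitInterval) (x : CotangentSphere n),
            ((S t : Equiv.Perm (CotangentSphere n)) x).1 = crossTwist B θ t x.1) ∧
          (∀ (s : unitInterval) (x : CotangentSphere n),
            ((S' s : Equiv.Perm (CotangentSphere n)) x).1 =
              crossTwist B (fun r => (1 - (s : ℝ)) * θ r + s * (2 * Real.pi)) 1 x.1) ∧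
          isotopyClass (S 0) = isotopyClass (τ ^ 2) ∧ S 1 = S' 0 ∧ S' 1 = 1 := by
  have hpos : 0 < n := by omega
  have heven : Even n := by rcases hn with rfl | rfl <;> decide
  obtain ⟨τ, hτ, huniq, hτf⟩ := hρ.exists_dehnTwist hpos
  refine ⟨⟨τ, hτ, huniq⟩, fun τ' hτ' => ?_⟩
  obtain rfl := huniq τ' hτ'
  obtain ⟨B, hB⟩ := exists_isCrossProduct hn
  refine ⟨?_, ⟨B, hB⟩, fun B hB R θ _ hθ h0 hR =>
    (exists_crossTwist_isotopies hB hρ hτf hθ h0 hR).2⟩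
  -- Any admissible angle function will do to see that the square is trivial; here a smooth step
  -- from `0` to `2π` on `[1, 2]`.
  have hsq : isotopyClass (τ' ^ 2) = 1 :=
    (exists_crossTwist_isotopies hB hρ hτf (R := 2)
      (θ := fun r => 2 * Real.pi * Real.smoothTransition (r - 1))
      (contDiff_const.mul (Real.smoothTransition.contDiff.comp (contDiff_id.sub contDiff_const)))
      (fun r hr => by rw [Real.smoothTransition.zero_of_nonpos (by linarith), mul_zero])
      (fun r hr => by rw [Real.smoothTransition.one_of_one_le (by linarith), mul_one])).1
  have hne : isotopyClass τ' ≠ 1 := fun h =>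
    not_mem_isotopicToId_of_antipodal heven
      (fun x hx => by rw [hτf, geodesicMap_of_snd_eq_zero _ hx]) (isotopyClass_eq_one_iff.1 h)
  have : Fact (Nat.Prime 2) := ⟨Nat.prime_two⟩
  exact orderOf_eq_prime hsq hne
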